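/- Notation. For $S\subseteq\mathbb C$ and $r>0$ let $\mathcal B_r(S)=\{z\in\mathbb C:\exists y\in S,\ |z-y|<r\}$, $\mathcal B_r(z_0)=\mathcal B_r(\{z_0\})$, and for $\boldsymbol\delta=(\delta_1,\dots,\delta_k)\in(0,\infty)^k$ let $\mathcal B_{\boldsymbol\delta}([-1,1])=\prod_{j=1}^k\mathcal B_{\delta_j}([-1,1])\subseteq\mathbb C^k$ and $\mathcal B_{\boldsymbol\delta}=\prod_{j=1}^k\mathcal B_{\delta_j}(0)$. Write $\boldsymbol x_{[k]}=(x_1,\dots,x_k)$, and let $\mu$ be the normalized Lebesgue (probability) measure on $[-1,1]^n$, for every $n$. $C^1$ on an open subset of $\mathbb C^k$ is meant in the complex sense, i.e. holomorphic. A probability density on $[-1,1]^d$ is a measurable, everywhere positive function with $\mu$-integral $1$. Knothe–Rosenblatt map. For a continuous probability density $f$ on $[-1,1]^d$ put $\hat f_k(\boldsymbol x)=\int_{[-1,1]^{d-k}}f(\boldsymbol x,t_{k+1},\dots,t_d)\,\mathrm d\mu(t)$ for $\boldsymbol x\in[-1,1]^k$, $0\le k\le d$; for $1\le k\le d$ put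 $f_k(\boldsymbol x)=\hat f_k(\boldsymbol x)/\hat f_{k-1}(\boldsymbol x_{[k-1]})$ and $F_{f;k}(\boldsymbol x_{[k-1]},x_k)=\frac12\int_{-1}^{x_k}f_k(\boldsymbol x_{[k-1]},t)\,\mathrm dt$. The Knothe–Rosenblatt map $T=(T_k)_{k=1}^d$ from $f_\rho$ to $f_\pi$ is defined inductively by $T_k(\boldsymbol x_{[k-1]},\cdot)=F_{f_\pi;k}(T_1(x_1),\dots,T_{k-1}(\boldsymbol x_{[k-1]}),\cdot)^{-1}\circ F_{f_\rho;k}(\boldsymbol x_{[k-1]},\cdot)$, the inverse being that of a bijection $[-1,1]\to[0,1]$. Theorem. Let $0<M\le L<\infty$. There exist constants $C_6,C_7,C_8>0$ depending only on $M$ and $L$ such that the following holds for all $d\in\mathbb N$ and $\boldsymbol\delta\in(0,\infty)^d$. Let $f_\rho,f_\pi$ be probability densities on $[-1,1]^d$ such that each $f\in\{f_\rho,f_\pi\}$ extends to a function $f\in C^1(\mathcal B_{\boldsymbol\delta}([-1,1]);\mathbb C)$ with (i) $M\le|f(\boldsymbol x)|\le L$ for all $\boldsymbol x\in\mathcal B_{\boldsymbol\delta}([-1,1])$;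 (ii) $\sup_{\boldsymbol y\in\mathcal B_{\boldsymbol\delta}}|f(\boldsymbol x+\boldsymbol y)-f(\boldsymbol x)|\le C_6$ for all $\boldsymbol x\in[-1,1]^d$; (iii) $\sup_{\boldsymbol y\in\mathcal B_{\boldsymbol\delta_{[k]}}\times\{0\}^{d-k}}|f(\boldsymbol x+\boldsymbol y)-f(\boldsymbol x)|\le C_6\,\delta_{k+1}$ for all $\boldsymbol x\in[-1,1]^d$ and $k\in\{1,\dots,d-1\}$. Let $T$ be the Knothe–Rosenblatt map from $f_\rho$ to $f_\pi$, and set $\zeta_k=C_7\delta_k$. Then for every $k\in\{1,\dots,d\}$ the partial derivative $R_k=\partial_{x_k}T_k$ exists on $[-1,1]^k$ and has an extension, again denoted $R_k$, such that (a) $R_k\in C^1(\mathcal B_{\boldsymbol\zeta_{[k]}}([-1,1]);\mathcal B_{C_8}(1))$ and $\operatorname{Re}R_k(\boldsymbol x)\ge 1/C_8$ for all $\boldsymbol x\in\mathcal B_{\boldsymbol\zeta_{[k]}}([-1,1])$; (b) if $k\ge2$, then $R_k(\boldsymbol x)\in\mathcal B_{C_8/\max\{1,\delta_k\}}(1)$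 for all $\boldsymbol x\in\mathcal B_{\boldsymbol\zeta_{[k-1]}}([-1,1])\times[-1,1]$. -/

import Mathlib

open MeasureTheory Set

noncomputable section

namespace KnotheRosenblatt

/-- The cube `[-1,1]^ι` in `ℝ^ι`. -/
def cube (ι : Type*) : Set (ι → ℝ) := {x | ∀ i, x i ∈ Icc (-1 : ℝ) 1}

/-- The real interval `[-1,1]` as a subset of `ℂ`. -/
def complexInterval : Set ℂ := (fun t : ℝ => (t : ℂ)) '' Icc (-1 : ℝ) 1

/-- A real vector regarded as a complex vector. -/
def toComplex {ι : Type*} (x : ι → ℝ) : ι → ℂ := fun i => (x i : ℂ)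

/-- The product `×_i B_{δ_i}([-1,1])` of the open `δ_i`-neighbourhoods of `[-1,1]` in `ℂ`. -/
def polystrip {ι : Type*} (δ : ι → ℝ) : Set (ι → ℂ) :=
  {z | ∀ i, z i ∈ Metric.thickening (δ i) complexInterval}

/-- The normalized Lebesgue measure on `[-1,1]`. -/
def mu₁ : Measure ℝ := (2⁻¹ : ENNReal) • volume.restrict (Icc (-1 : ℝ) 1)

/-- The product of normalized Lebesgue measures on `[-1,1]^ι`. -/
def mu (ι : Type*) [Fintype ι] : Measure (ι → ℝ) := Measure.pi fun _ => mu₁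

/-- `f` is a positive probability density on `[-1,1]^d` with respect to `mu`.
Only the values of `f` on the cube matter. -/
structure IsProbDensity {d : ℕ} (f : (Fin d → ℝ) → ℝ) : Prop where
  measurable : Measurable fun x : cube (Fin d) => f x
  pos : ∀ x ∈ cube (Fin d), 0 < f x
  integral_eq_one : ∫ x, f x ∂(mu (Fin d)) = 1

/-- The marginal `x ↦ ∫_{[-1,1]^{d-k}} f(x, t_{k+1}, …, t_d) μ(dt)` in the first `k` variables. -/
def marginal {d : ℕ} (f : (Fin d → ℝ) → ℝ) (k : ℕ) (x : Fin k → ℝ) : ℝ :=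
  ∫ t : {i : Fin d // k ≤ i.val} → ℝ,
    f (fun i => if h : i.val < k then x ⟨i.val, h⟩ else t ⟨i, not_lt.mp h⟩)
    ∂(mu {i : Fin d // k ≤ i.val})

/-- The density of the variable with (0-based) index `k`, conditioned on the variables before it. -/
def condDensity {d : ℕ} (f : (Fin d → ℝ) → ℝ) (k : ℕ) (x : Fin (k + 1) → ℝ) : ℝ :=
  marginal f (k + 1) x / marginal f k (Fin.init x)

/-- The distribution function, in the variable with (0-based) index `k`, of the conditional
density given the previous variables `x`. -/
def condCDF {d : ℕ} (f : (Fin d → ℝ) → ℝ) (k : ℕ) (x : Fin k → ℝ) (s : ℝ) : ℝ :=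
  (1 / 2) * ∫ t in (-1 : ℝ)..s, condDensity f k (Fin.snoc (α := fun _ => ℝ) x t)

/-- The first `k` components of the Knothe–Rosenblatt map from the density `fρ` to the density
`fπ`, as functions of the first `k` variables. The last component is the inverse on `[-1,1]` of the
conditional distribution function of the target (at the previously computed components), applied
to the conditional distribution function of the reference. -/
def krMap {d : ℕ} (fρ fπ : (Fin d → ℝ) → ℝ) : (k : ℕ) → (Fin k → ℝ) → (Fin k → ℝ)
  | 0, _ => Fin.elim0
  | k + 1, x =>
    Fin.snoc (α := fun _ => ℝ) (krMap fρ fπ k (Fin.init x))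
      (Function.invFunOn (condCDF fπ k (krMap fρ fπ k (Fin.init x))) (Icc (-1 : ℝ) 1)
        (condCDF fρ k (Fin.init x) (x (Fin.last k))))

/-- The component with (0-based) index `k` of the Knothe–Rosenblatt map, a function of the first
`k + 1` variables. -/
def krComponent {d : ℕ} (fρ fπ : (Fin d → ℝ) → ℝ) (k : ℕ) (x : Fin (k + 1) → ℝ) : ℝ :=
  krMap fρ fπ (k + 1) x (Fin.last k)

/-- `f` is a positive probability density on `[-1,1]^d`, and `g` is a holomorphic extension of it
to the polystrip of radii `δ`, with modulus in `[M, L]` there and with small variation, as measured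
by `C`. -/
structure DensityAssumption {d : ℕ} (M L C : ℝ) (δ : Fin d → ℝ)
    (f : (Fin d → ℝ) → ℝ) (g : (Fin d → ℂ) → ℂ) : Prop where
  density : IsProbDensity f
  extends_f : ∀ x ∈ cube (Fin d), g (toComplex x) = (f x : ℂ)
  contDiffOn : ContDiffOn ℂ 1 g (polystrip δ)
  bounds : ∀ z ∈ polystrip δ, M ≤ ‖g z‖ ∧ ‖g z‖ ≤ L
  small : ∀ x ∈ cube (Fin d), ∀ y : Fin d → ℂ, (∀ i, ‖y i‖ < δ i) →
    ‖g (toComplex x + y) - g (toComplex x)‖ ≤ C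
  small_partial : ∀ x ∈ cube (Fin d), ∀ j : Fin d, 1 ≤ j.val → ∀ y : Fin d → ℂ,
    (∀ i, i < j → ‖y i‖ < δ i) → (∀ i, j ≤ i → y i = 0) →
    ‖g (toComplex x + y) - g (toComplex x)‖ ≤ C * δ j

end KnotheRosenblatt

end

/-! The marginals, and hence the conditional densities, extend holomorphically to the polystrip. On
the real cube the conditional densities lie in `[M/L, L/M]`, and the smallness constant `C` makes
the complex ones a small perturbation of these: bounded, with real part bounded below and small
imaginary part (`complexCond_bounds`). Their normalized primitives in the last variable,
`halfPrimitive (complexCond g k z)`, extend the conditional distribution functions. Each component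
`τ` of the extended map is then the solution of `H_π(T(z'), τ) = H_ρ(z', z_k)`, where `H` denotes
these primitives and `z'` the earlier variables.

Since the derivative of `H_π(w, ·)` has real part bounded below and bounded modulus, this function
is injective on the strip and expands balls by a constant `κ = κ(M, L)`
(`exists_expansion_constant`). Solvability compares with real data: real distribution functions all
map `[-1,1]` onto `[0,1]`, so `H_ρ(z', z_k)` is close to `H_π(w, t')` for some real `t'`, whatever
the complex point `w` in the polystrip (`exists_near_solution`). Expansion around `t'` yields a
root. The induction therefore only needs the earlier components to map into the polystrip of radii
`δ`, and one factor `c` serves for all indices and all dimensions. Injectivity makes the root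
unique, which gives both holomorphy (`contDiffOn_of_implicit`) and agreement with the real map.

Implicit differentiation gives `R_k` as the quotient of the two conditional densities, which yields
(a). For (b), a conditional density has mean `1` over `[-1,1]` even at complex parameters, by
Fubini, and a Cauchy estimate on a strip of radius `δ_k` bounds its derivative by `O(1/δ_k)`. So
near `[-1,1]` it is within `O(1/δ_k)` of `1`. The hypotheses (ii) and (iii) together keep `τ` within
`min(1, δ_k)/2` of `[-1,1]` when `z_k` is real, so this applies to both densities. -/

noncomputable section

namespace KnotheRosenblatt

open Filter Topology Metric

/-! ### Parametric integrals of holomorphic functions -/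

section ParametricIntegral

variable {E V X : Type*} [NormedAddCommGroup E] [NormedSpace ℂ E] [FiniteDimensional ℂ E]
  [NormedAddCommGroup V] [NormedSpace ℂ V] [TopologicalSpace X]

/-- Near a point of `U`, a function that is continuous on `U ×ˢ K` with `K` compact is bounded,
uniformly in `K`. -/
lemma exists_eventually_bound_of_compact {G : Type*} [NormedAddCommGroup G] {U : Set E}
    (hU : IsOpen U) {K : Set X} (hK : IsCompact K) {Φ : E → X → G}
    (hΦ : ContinuousOn (Function.uncurry Φ) (U ×ˢ K)) {z₀ : E} (hz₀ : z₀ ∈ U) :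
    ∃ B : ℝ, ∃ s ∈ 𝓝 z₀, s ⊆ U ∧ ∀ z ∈ s, ∀ x ∈ K, ‖Φ z x‖ ≤ B := by
  have : ProperSpace E := FiniteDimensional.proper ℂ E
  obtain ⟨r, hr, hrU⟩ := nhds_basis_closedBall.mem_iff.1 (hU.mem_nhds hz₀)
  have hc : IsCompact (closedBall z₀ r ×ˢ K) := (isCompact_closedBall z₀ r).prod hK
  obtain ⟨B, hB⟩ := hc.exists_bound_of_continuousOn (hΦ.mono (prod_mono_left hrU))
  exact ⟨B, closedBall z₀ r, closedBall_mem_nhds z₀ hr, hrU, fun z hz x hx => hB (z, x) ⟨hz, hx⟩⟩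

lemma continuousOn_slice {E X G : Type*} [TopologicalSpace E] [TopologicalSpace X]
    [TopologicalSpace G] {U : Set E} {K : Set X} {Φ : E → X → G}
    (hΦ : ContinuousOn (Function.uncurry Φ) (U ×ˢ K)) {z : E} (hz : z ∈ U) :
    ContinuousOn (Φ z) K :=
  hΦ.comp (f := fun x => (z, x)) (by fun_prop) fun _ hx => ⟨hz, hx⟩

variable [MeasurableSpace X] [OpensMeasurableSpace X] [T2Space X]

/-- The integral over a compact set of a family of `C^1` functions is `C^1`. -/
lemma contDiffOn_one_setIntegral {U : Set E} (hU : IsOpen U) {K : Set X} (hK : IsCompact K)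
    (μ : Measure X) [IsFiniteMeasure μ] {Φ : E → X → ℂ} {Φ' : E → X → E →L[ℂ] ℂ}
    (hΦ : ContinuousOn (Function.uncurry Φ) (U ×ˢ K))
    (hΦ' : ContinuousOn (Function.uncurry Φ') (U ×ˢ K))
    (hd : ∀ z ∈ U, ∀ x ∈ K, HasFDerivAt (fun z => Φ z x) (Φ' z x) z) :
    ContDiffOn ℂ 1 (fun z => ∫ x in K, Φ z x ∂μ) U := by
  have hKm : MeasurableSet K := hK.measurableSet
  have hderiv : ∀ z ∈ U, HasFDerivAt (fun z => ∫ x in K, Φ z x ∂μ) (∫ x in K, Φ' z x ∂μ) z := by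
    intro z₀ hz₀
    obtain ⟨B, s, hs, hsU, hB⟩ := exists_eventually_bound_of_compact hU hK hΦ' hz₀
    refine hasFDerivAt_integral_of_dominated_of_fderiv_le (bound := fun _ => B) hs ?_ ?_
      ((continuousOn_slice hΦ' hz₀).aestronglyMeasurable_of_isCompact hK hKm) ?_ (integrable_const _) ?_
    · filter_upwards [hU.mem_nhds hz₀] with z hz using
        (continuousOn_slice hΦ hz).aestronglyMeasurable_of_isCompact hK hKm
    · exact (continuousOn_slice hΦ hz₀).integrableOn_compact hK
    · filter_upwards [ae_restrict_mem hKm] with x hx z hz using hB z hz x hx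
    · filter_upwards [ae_restrict_mem hKm] with x hx z hz using hd z (hsU hz) x hx
  rw [show (1 : WithTop ℕ∞) = 0 + 1 from (zero_add 1).symm,
    contDiffOn_succ_iff_hasFDerivWithinAt_of_uniqueDiffOn hU.uniqueDiffOn]
  refine ⟨fun h => by simp at h, fun z => ∫ x in K, Φ' z x ∂μ, ?_,
    fun z hz => (hderiv z hz).hasFDerivWithinAt⟩
  rw [contDiffOn_zero]
  intro z₀ hz₀
  obtain ⟨B, s, hs, hsU, hB⟩ := exists_eventually_bound_of_compact hU hK hΦ' hz₀
  refine continuousWithinAt_of_dominated (bound := fun _ => B) ?_ ?_ (integrable_const _) ?_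
  · filter_upwards [self_mem_nhdsWithin] with z hz using
      (continuousOn_slice hΦ' hz).aestronglyMeasurable_of_isCompact hK hKm
  · filter_upwards [mem_nhdsWithin_of_mem_nhds hs] with z hz
    filter_upwards [ae_restrict_mem hKm] with x hx using hB z hz x hx
  · filter_upwards [ae_restrict_mem hKm] with x hx
    exact (hΦ'.comp (f := fun z => (z, x)) (by fun_prop) fun z hz => ⟨hz, hx⟩) z₀ hz₀

/-- Integrating a `C^1` function along a continuous family of affine maps gives a `C^1` function. -/
lemma contDiffOn_one_setIntegral_affine {U : Set E} (hU : IsOpen U) {K : Set X} (hK : IsCompact K)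
    (μ : Measure X) [IsFiniteMeasure μ] {W : Set V} (hW : IsOpen W) {φ : V → ℂ}
    (hφ : ContDiffOn ℂ 1 φ W) {A : X → E →L[ℂ] V} {b : X → V}
    (hA : Continuous A) (hb : Continuous b)
    (hmaps : ∀ z ∈ U, ∀ x ∈ K, A x z + b x ∈ W) :
    ContDiffOn ℂ 1 (fun z => ∫ x in K, φ (A x z + b x) ∂μ) U := by
  have hcont : Continuous fun p : E × X => A p.2 p.1 + b p.2 := by fun_prop
  have hm : MapsTo (fun p : E × X => A p.2 p.1 + b p.2) (U ×ˢ K) W :=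
    fun p hp => hmaps p.1 hp.1 p.2 hp.2
  refine contDiffOn_one_setIntegral hU hK μ (Φ' := fun z x => (fderiv ℂ φ (A x z + b x)).comp (A x))
    (hφ.continuousOn.comp hcont.continuousOn hm) ?_ ?_
  · have h1 := (hφ.continuousOn_fderiv_of_isOpen hW le_rfl).comp hcont.continuousOn hm
    exact h1.clm_comp (hA.comp continuous_snd).continuousOn
  · intro z hz x hx
    have h1 := ((hφ.differentiableOn one_ne_zero).differentiableAt
      (hW.mem_nhds (hmaps z hz x hx))).hasFDerivAt
    exact h1.comp z ((A x).hasFDerivAt.add_const (b x))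

end ParametricIntegral

/-! ### Primitives along segments -/

/-- Half of the primitive of `h` vanishing at `-1`, integrating along the segment from `-1`. -/
def halfPrimitive (h : ℂ → ℂ) (s : ℂ) : ℂ :=
  1 / 2 * ((s + 1) * ∫ u in Icc (0 : ℝ) 1, h (-1 + u * (s + 1)))

@[simp] lemma halfPrimitive_neg_one (h : ℂ → ℂ) : halfPrimitive h (-1) = 0 := by
  simp [halfPrimitive]

/-- The open `r`-neighbourhood of `[-1,1]` in `ℂ`. -/
abbrev strip (r : ℝ) : Set ℂ := thickening r complexInterval

lemma complexInterval_eq_segment : complexInterval = segment ℝ (-1 : ℂ) 1 := by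
  have h := image_segment ℝ Complex.ofRealCLM.toLinearMap.toAffineMap (-1 : ℝ) 1
  rw [segment_eq_Icc (by norm_num)] at h
  simpa [complexInterval] using h

lemma convex_strip (r : ℝ) : Convex ℝ (strip r) := by
  unfold strip
  rw [complexInterval_eq_segment]
  exact (convex_segment _ _).thickening r

lemma isOpen_strip (r : ℝ) : IsOpen (strip r) := isOpen_thickening

lemma ofReal_mem_complexInterval {t : ℝ} (ht : t ∈ Icc (-1 : ℝ) 1) : (t : ℂ) ∈ complexInterval :=
  ⟨t, ht, rfl⟩

lemma ofReal_mem_strip {r : ℝ} (hr : 0 < r) {t : ℝ} (ht : t ∈ Icc (-1 : ℝ) 1) :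
    (t : ℂ) ∈ strip r :=
  self_subset_thickening hr _ (ofReal_mem_complexInterval ht)

lemma neg_one_mem_strip {r : ℝ} (hr : 0 < r) : (-1 : ℂ) ∈ strip r := by
  simpa using ofReal_mem_strip hr (t := -1) (by norm_num)

lemma mem_strip_iff {r : ℝ} {s : ℂ} :
    s ∈ strip r ↔ ∃ t ∈ Icc (-1 : ℝ) 1, ‖s - t‖ < r := by
  simp only [strip, mem_thickening_iff, complexInterval, exists_mem_image, dist_eq_norm]

lemma mem_strip_of_segment {r : ℝ} (hr : 0 < r) {s : ℂ} (hs : s ∈ strip r) {u : ℝ}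
    (hu : u ∈ Icc (0 : ℝ) 1) : -1 + u * (s + 1) ∈ strip r := by
  have := (convex_strip r).add_smul_sub_mem (neg_one_mem_strip hr) hs hu
  simpa [mul_add] using this

lemma halfPrimitive_eq_of_hasDerivAt {r : ℝ} (hr : 0 < r) {h H : ℂ → ℂ}
    (hh : ContinuousOn h (strip r)) (hH : ∀ s ∈ strip r, HasDerivAt H (h s) s) {s : ℂ}
    (hs : s ∈ strip r) : halfPrimitive h s = 1 / 2 * (H s - H (-1)) := by
  have hd : ∀ u ∈ uIcc (0 : ℝ) 1, HasDerivAt (fun u : ℝ => H (-1 + u * (s + 1)))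
      ((s + 1) * h (-1 + u * (s + 1))) u := by
    intro u hu
    rw [uIcc_of_le zero_le_one] at hu
    have h1 : HasDerivAt (fun u : ℝ => -1 + (u : ℂ) * (s + 1)) (s + 1) u := by
      simpa using ((Complex.ofRealCLM.hasDerivAt (x := u)).mul_const (s + 1)).const_add (-1)
    simpa [Function.comp_def, mul_comm] using
      (hH _ (mem_strip_of_segment hr hs hu)).comp_of_eq (x := u) (h := fun u : ℝ => -1 + (u : ℂ) * (s + 1)) h1 rfl
  have hint : IntervalIntegrable (fun u : ℝ => (s + 1) * h (-1 + u * (s + 1))) volume 0 1 := by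
    refine ContinuousOn.intervalIntegrable (continuousOn_const.mul (hh.comp (by fun_prop) ?_))
    intro u hu
    rw [uIcc_of_le zero_le_one] at hu
    exact mem_strip_of_segment hr hs hu
  have := intervalIntegral.integral_eq_sub_of_hasDerivAt hd hint
  rw [intervalIntegral.integral_const_mul, intervalIntegral.integral_of_le zero_le_one,
    ← integral_Icc_eq_integral_Ioc] at this
  simp [halfPrimitive, this]

/-- A holomorphic function on the convex strip has a primitive, and integration along segments
recovers it up to the value at `-1`. -/
lemma hasDerivAt_halfPrimitive {r : ℝ} (hr : 0 < r) {h : ℂ → ℂ}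
    (hh : DifferentiableOn ℂ h (strip r)) {s : ℂ} (hs : s ∈ strip r) :
    HasDerivAt (halfPrimitive h) (h s / 2) s := by
  obtain ⟨H, hH⟩ := (convex_strip r).exists_forall_hasDerivWithinAt hh
  have hH' : ∀ s ∈ strip r, HasDerivAt H (h s) s := fun s hs =>
    (hH s hs).hasDerivAt ((isOpen_strip r).mem_nhds hs)
  have h1 : HasDerivAt (fun s => 1 / 2 * (H s - H (-1))) (h s / 2) s := by
    rw [show h s / 2 = 1 / 2 * h s by ring]
    exact ((hH' s hs).sub_const (H (-1))).const_mul (1 / 2 : ℂ)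
  refine h1.congr_of_eventuallyEq ?_
  filter_upwards [(isOpen_strip r).mem_nhds hs] with w hw
  exact halfPrimitive_eq_of_hasDerivAt hr hh.continuousOn hH' hw

lemma halfPrimitive_ofReal {r : ℝ} (hr : 0 < r) {h : ℂ → ℂ}
    (hh : DifferentiableOn ℂ h (strip r)) {t : ℝ} (ht : t ∈ Icc (-1 : ℝ) 1) :
    halfPrimitive h t = 1 / 2 * ∫ τ in (-1 : ℝ)..t, h τ := by
  have hsub : ∀ τ ∈ uIcc (-1 : ℝ) t, (τ : ℂ) ∈ strip r := by
    intro τ hτ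
    rw [uIcc_of_le ht.1] at hτ
    exact ofReal_mem_strip hr ⟨hτ.1, hτ.2.trans ht.2⟩
  have := intervalIntegral.integral_eq_sub_of_hasDerivAt
    (f := fun τ : ℝ => halfPrimitive h τ) (f' := fun τ : ℝ => h τ / 2) (a := -1) (b := t)
    (fun τ hτ => (hasDerivAt_halfPrimitive hr hh (hsub τ hτ)).comp_ofReal)
    (ContinuousOn.intervalIntegrable ((hh.continuousOn.comp (by fun_prop) hsub).div_const 2))
  simp only [intervalIntegral.integral_div, Complex.ofReal_neg, Complex.ofReal_one,
    halfPrimitive_neg_one, sub_zero] at this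
  rw [← this]
  ring

/-- The half primitive depends holomorphically on parameters. -/
lemma contDiffOn_halfPrimitive {E : Type*} [NormedAddCommGroup E] [NormedSpace ℂ E]
    [FiniteDimensional ℂ E] {P : Set E} (hP : IsOpen P) {r : ℝ} (hr : 0 < r) {q : E → ℂ → ℂ}
    (hq : ContDiffOn ℂ 1 (fun p : E × ℂ => q p.1 p.2) (P ×ˢ strip r)) :
    ContDiffOn ℂ 1 (fun p : E × ℂ => halfPrimitive (q p.1) p.2) (P ×ˢ strip r) := by
  have hW : IsOpen (P ×ˢ strip r) := hP.prod (isOpen_strip r)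
  let A : ℝ → E × ℂ →L[ℂ] E × ℂ := fun u =>
    (ContinuousLinearMap.fst ℂ E ℂ).prod ((u : ℂ) • ContinuousLinearMap.snd ℂ E ℂ)
  have hA : Continuous A := by
    have : A = fun u : ℝ => (ContinuousLinearMap.fst ℂ E ℂ).prod 0 +
        (u : ℂ) • (0 : E × ℂ →L[ℂ] E).prod (ContinuousLinearMap.snd ℂ E ℂ) := by
      ext u <;> simp [A]
    rw [this]
    fun_prop
  have h1 := contDiffOn_one_setIntegral_affine hW (isCompact_Icc (a := (0 : ℝ)) (b := 1))
    (volume.restrict (Icc (0 : ℝ) 1)) hW hq (A := A)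
    (b := fun u : ℝ => ((0 : E), (u : ℂ) - 1)) hA (by fun_prop) (by
      intro p hp u hu
      refine ⟨by simpa [A] using hp.1, ?_⟩
      have := mem_strip_of_segment hr hp.2 hu
      convert this using 1
      simp [A]
      ring)
  -- The finite measure `volume.restrict (Icc 0 1)` was supplied instead of `volume`, so the double
  -- restriction has to be collapsed.
  rw [Measure.restrict_restrict_of_subset subset_rfl] at h1
  have h2 : ContDiffOn ℂ 1 (fun p : E × ℂ => p.2 + 1) (P ×ˢ strip r) := by fun_prop
  refine (contDiffOn_const (c := (1 / 2 : ℂ))).mul (h2.mul (h1.congr fun p hp => ?_))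
  refine integral_congr_ae (Eventually.of_forall fun u => ?_)
  simp only [A, ContinuousLinearMap.prod_apply, ContinuousLinearMap.coe_fst', Prod.fst_add, Prod.snd_add,
    _root_.smul_apply, ContinuousLinearMap.coe_snd', smul_eq_mul, add_zero]
  congr 1
  ring

/-! ### Holomorphic functions whose derivative has positive real part -/

/-- With `a = l² / m`, expanding gives `‖w - a‖² ≤ l² - 2am + a² = a² - l²`. The half-disc of
admissible derivatives thus sits in a disc around `a` of radius less than `a`, which excludes `0`.
-/
lemma norm_sub_ofReal_le {m l : ℝ} (hm : 0 < m) {w : ℂ} (hw : ‖w‖ ≤ l) (hre : m ≤ w.re) :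
    ‖w - (l ^ 2 / m : ℝ)‖ ≤ √((l ^ 2 / m) ^ 2 - l ^ 2) := by
  apply Real.le_sqrt_of_sq_le
  have h1 : ‖w‖ ^ 2 ≤ l ^ 2 := by gcongr
  rw [← Complex.normSq_eq_norm_sq, Complex.normSq_apply] at h1 ⊢
  simp only [Complex.sub_re, Complex.ofReal_re, Complex.sub_im, Complex.ofReal_im, sub_zero]
  have h2 : l ^ 2 / m * m ≤ l ^ 2 / m * w.re := by gcongr
  rw [div_mul_cancel₀ _ hm.ne'] at h2
  nlinarith

/-- A holomorphic function on a convex set whose derivative has modulus at most `l` and real part at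
least `m > 0` is injective, and expands balls by a factor depending only on `m` and `l`. -/
lemma exists_expansion_constant {m l : ℝ} (hm : 0 < m) (hml : m ≤ l) :
    ∃ κ : ℝ, 0 < κ ∧ ∀ (S : Set ℂ) (h h' : ℂ → ℂ), Convex ℝ S → (∀ s ∈ S, HasDerivAt h (h' s) s) →
      (∀ s ∈ S, ‖h' s‖ ≤ l) → (∀ s ∈ S, m ≤ (h' s).re) →
      InjOn h S ∧ ∀ s₀ r, 0 ≤ r → closedBall s₀ r ⊆ S →
        SurjOn h (closedBall s₀ r) (closedBall (h s₀) (κ * r)) := by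
  have hl : 0 < l := hm.trans_le hml
  set a : ℝ := l ^ 2 / m with ha
  have ha0 : 0 < a := by positivity
  have hc : √(a ^ 2 - l ^ 2) < a := by
    rw [Real.sqrt_lt' ha0]
    nlinarith
  refine ⟨a - √(a ^ 2 - l ^ 2), by linarith, fun S h h' hS hd hl' hre => ?_⟩
  have hac : (a : ℂ) ≠ 0 := by exact_mod_cast ha0.ne'
  let e : ℂ ≃L[ℂ] ℂ := ContinuousLinearEquiv.unitsEquivAut ℂ (Units.mk0 (a : ℂ) hac)
  have he : ∀ s, e s = s * a := fun s => rfl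
  let c : NNReal := (√(a ^ 2 - l ^ 2)).toNNReal
  -- By the mean value inequality for `h s - a * s`, the function `h` is multiplication by `a` up to
  -- a Lipschitz error smaller than `a`. Injectivity and the expansion factor `a - √(a² - l²)`
  -- follow.
  have happ : ∀ x ∈ S, ∀ y ∈ S, ‖h y - h x - a * (y - x)‖ ≤ √(a ^ 2 - l ^ 2) * ‖y - x‖ := by
    intro x hx y hy
    have := hS.norm_image_sub_le_of_norm_hasDerivWithin_le (f := fun s => h s - a * s)
      (f' := fun s => h' s - a) (C := √(a ^ 2 - l ^ 2))
      (fun s hs => ((hd s hs).sub (by simpa using (hasDerivAt_id s).const_mul (a : ℂ))).hasDerivWithinAt)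
      (fun s hs => norm_sub_ofReal_le hm (hl' s hs) (hre s hs)) hx hy
    rwa [show h y - h x - a * (y - x) = h y - a * y - (h x - a * x) by ring]
  constructor
  · intro x hx y hy hxy
    by_contra hne
    have h1 := happ x hx y hy
    rw [hxy, sub_self, zero_sub, norm_neg, norm_mul, Complex.norm_real, Real.norm_of_nonneg ha0.le] at h1
    have : 0 < ‖y - x‖ := norm_pos_iff.2 (sub_ne_zero.2 (Ne.symm hne))
    exact absurd (le_of_mul_le_mul_right h1 this) (not_le.2 hc)
  · intro s₀ r hr hsub
    have happ' : ApproximatesLinearOn h (e : ℂ →L[ℂ] ℂ) S c := by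
      intro x hx y hy
      have := happ y hy x hx
      simpa [he, mul_comm, c] using this
    let inv : (e : ℂ →L[ℂ] ℂ).NonlinearRightInverse :=
      { toFun := fun y => y * (a : ℂ)⁻¹
        nnnorm := a⁻¹.toNNReal
        bound' := fun y => by simp [abs_of_pos ha0, ha0.le, mul_comm]
        right_inv' := fun y => by simp [he, hac] }
    have := happ'.surjOn_closedBall_of_nonlinearRightInverse inv hr hsub
    simpa [inv, c, ha0.le] using this

/-! ### Implicit functions with a global uniqueness property -/

/-- No continuity of `τ` is assumed: the local implicit function stays in `S` near `x₀`, and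
injectivity on `S` forces `τ` to coincide with it there. -/
lemma contDiffOn_of_implicit {E : Type*} [NormedAddCommGroup E] [NormedSpace ℂ E]
    [CompleteSpace E] {U : Set E} (hU : IsOpen U) {S : Set ℂ} (hS : IsOpen S) {Ψ : E × ℂ → ℂ}
    {Ψ' : E → ℂ → ℂ} (hΨ : ContDiffOn ℂ 1 Ψ (U ×ˢ S))
    (hd : ∀ x ∈ U, ∀ s ∈ S, HasDerivAt (fun s => Ψ (x, s)) (Ψ' x s) s)
    (hne : ∀ x ∈ U, ∀ s ∈ S, Ψ' x s ≠ 0) (hinj : ∀ x ∈ U, InjOn (fun s => Ψ (x, s)) S)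
    {τ : E → ℂ} (hτ : ∀ x ∈ U, τ x ∈ S) (hzero : ∀ x ∈ U, Ψ (x, τ x) = 0) :
    ContDiffOn ℂ 1 τ U := by
  intro x₀ hx₀
  have hmem : (x₀, τ x₀) ∈ U ×ˢ S := ⟨hx₀, hτ x₀ hx₀⟩
  have cd : ContDiffAt ℂ 1 Ψ (x₀, τ x₀) := hΨ.contDiffAt ((hU.prod hS).mem_nhds hmem)
  have hfd : fderiv ℂ Ψ (x₀, τ x₀) ∘L .inr ℂ E ℂ =
      (ContinuousLinearEquiv.unitsEquivAut ℂ
        (Units.mk0 _ (hne x₀ hx₀ _ (hτ x₀ hx₀))) : ℂ ≃L[ℂ] ℂ) := by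
    have h1 : HasFDerivAt (fun s => Ψ (x₀, s)) (fderiv ℂ Ψ (x₀, τ x₀) ∘L .inr ℂ E ℂ) (τ x₀) :=
      (cd.differentiableAt one_ne_zero).hasFDerivAt.comp (τ x₀) (hasFDerivAt_prodMk_right x₀ (τ x₀))
    have h2 := h1.unique (hd x₀ hx₀ _ (hτ x₀ hx₀)).hasFDerivAt
    rw [h2]
    ext
    simp
  have hinv : (fderiv ℂ Ψ (x₀, τ x₀) ∘L .inr ℂ E ℂ).IsInvertible := ⟨_, hfd.symm⟩
  have hψ := cd.contDiffAt_implicitFunction one_ne_zero hinv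
  have hself := cd.implicitFunction_apply_self one_ne_zero hinv
  have hev := cd.eventually_apply_implicitFunction one_ne_zero hinv
  simp only at hψ hself hev
  have hcont : ∀ᶠ x in 𝓝 x₀, cd.implicitFunction one_ne_zero hinv x ∈ S :=
    hψ.continuousAt.eventually_mem (by rw [hself]; exact hS.mem_nhds (hτ x₀ hx₀))
  refine (hψ.congr_of_eventuallyEq ?_).contDiffWithinAt
  filter_upwards [hev, hcont, hU.mem_nhds hx₀] with x h1 h2 hx
  exact hinj x hx (hτ x hx) h2 (by simp only [hzero x hx, h1, hzero x₀ hx₀])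

/-! ### The cube and its uniform measure -/

section Cube

variable {ι : Type*}

lemma cube_eq_pi : cube ι = univ.pi fun _ => Icc (-1 : ℝ) 1 := by
  ext x
  simp only [cube, mem_univ_pi]
  rfl

lemma isCompact_cube : IsCompact (cube ι) := by
  rw [cube_eq_pi]
  exact isCompact_univ_pi fun _ => isCompact_Icc

instance : IsProbabilityMeasure mu₁ := by
  refine ⟨?_⟩
  simp only [mu₁, Measure.smul_apply, Measure.restrict_apply_univ, Real.volume_Icc, smul_eq_mul]
  norm_num
  exact ENNReal.inv_mul_cancel (by norm_num) (by norm_num)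

lemma ae_mem_Icc : ∀ᵐ t ∂mu₁, t ∈ Icc (-1 : ℝ) 1 :=
  Measure.ae_smul_measure (ae_restrict_mem measurableSet_Icc) _

lemma integral_mu₁ (φ : ℝ → ℂ) : ∫ t, φ t ∂mu₁ = 1 / 2 * ∫ t in (-1 : ℝ)..1, φ t := by
  rw [mu₁, integral_smul_measure, intervalIntegral.integral_of_le (by norm_num),
    integral_Icc_eq_integral_Ioc]
  simp

variable [Fintype ι]

instance : IsProbabilityMeasure (mu ι) := by
  unfold mu
  infer_instance

lemma ae_mem_cube : ∀ᵐ t ∂mu ι, t ∈ cube ι := by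
  simp only [cube, mem_ofPred_eq, eventually_all]
  exact fun i => (Measure.quasiMeasurePreserving_eval (μ := fun _ : ι => mu₁) i).ae ae_mem_Icc

lemma restrict_mu_cube : (mu ι).restrict (cube ι) = mu ι :=
  Measure.restrict_eq_self_of_ae_mem ae_mem_cube

end Cube

/-! ### Polystrips -/

lemma isOpen_polystrip {ι : Type*} [Finite ι] (δ : ι → ℝ) : IsOpen (polystrip δ) := by
  have : polystrip δ = univ.pi fun i => strip (δ i) := by
    ext
    simp [polystrip]
  rw [this]
  exact isOpen_set_pi finite_univ fun i _ => isOpen_strip _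

lemma exists_cube_of_mem_polystrip {ι : Type*} {δ : ι → ℝ} {z : ι → ℂ} (hz : z ∈ polystrip δ) :
    ∃ x ∈ cube ι, ∀ i, ‖z i - x i‖ < δ i := by
  choose x hx hxz using fun i => mem_strip_iff.1 (hz i)
  exact ⟨x, hx, hxz⟩

lemma mem_polystrip_of_norm_sub_lt {ι : Type*} {δ : ι → ℝ} {z : ι → ℂ} {x : ι → ℝ}
    (hx : x ∈ cube ι) (hz : ∀ i, ‖z i - x i‖ < δ i) : z ∈ polystrip δ :=
  fun i => mem_strip_iff.2 ⟨x i, hx i, hz i⟩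

lemma toComplex_mem_polystrip {ι : Type*} {δ : ι → ℝ} (hδ : ∀ i, 0 < δ i) {x : ι → ℝ}
    (hx : x ∈ cube ι) : toComplex x ∈ polystrip δ :=
  fun i => ofReal_mem_strip (hδ i) (hx i)

/-- The first `k` entries of a vector of length `d`. -/
abbrev head {d k : ℕ} (δ : Fin d → ℝ) (h : k ≤ d) : Fin k → ℝ := fun i => δ (Fin.castLE h i)

lemma snoc_mem_cube {k : ℕ} {x : Fin k → ℝ} (hx : x ∈ cube (Fin k)) {t : ℝ}
    (ht : t ∈ Icc (-1 : ℝ) 1) :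
    (Fin.snoc (α := fun _ => ℝ) x t : Fin (k + 1) → ℝ) ∈ cube (Fin (k + 1)) := by
  intro i
  refine Fin.lastCases ?_ (fun j => ?_) i
  · simpa using ht
  · simpa using hx j

lemma toComplex_snoc {k : ℕ} (x : Fin k → ℝ) (t : ℝ) :
    toComplex (Fin.snoc (α := fun _ => ℝ) x t : Fin (k + 1) → ℝ) =
      Fin.snoc (α := fun _ => ℂ) (toComplex x) (t : ℂ) := by
  ext i
  refine Fin.lastCases ?_ (fun j => ?_) i <;> simp [toComplex]

lemma snoc_mem_polystrip {d k : ℕ} {δ : Fin d → ℝ} (hk : k < d) {z : Fin k → ℂ}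
    (hz : z ∈ polystrip (head δ hk.le)) {s : ℂ} (hs : s ∈ strip (δ ⟨k, hk⟩)) :
    (Fin.snoc (α := fun _ => ℂ) z s : Fin (k + 1) → ℂ) ∈
      polystrip (head δ (Nat.succ_le_of_lt hk)) := by
  intro i
  refine Fin.lastCases ?_ (fun j => ?_) i
  · rw [Fin.snoc_last]
    exact hs
  · rw [Fin.snoc_castSucc]
    exact hz j

lemma init_mem_polystrip {d k : ℕ} {δ : Fin d → ℝ} (hk : k < d) {z : Fin (k + 1) → ℂ}
    (hz : z ∈ polystrip (head δ (Nat.succ_le_of_lt hk))) :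
    Fin.init z ∈ polystrip (head δ hk.le) := fun i => hz i.castSucc

lemma last_mem_strip {d k : ℕ} {δ : Fin d → ℝ} (hk : k < d) {z : Fin (k + 1) → ℂ}
    (hz : z ∈ polystrip (head δ (Nat.succ_le_of_lt hk))) :
    z (Fin.last k) ∈ strip (δ ⟨k, hk⟩) := hz (Fin.last k)

lemma contDiff_snoc (k : ℕ) : ContDiff ℂ 1
    fun p : (Fin k → ℂ) × ℂ => (Fin.snoc (α := fun _ => ℂ) p.1 p.2 : Fin (k + 1) → ℂ) := by
  rw [contDiff_pi]
  intro i
  refine Fin.lastCases ?_ (fun j => ?_) i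
  · simpa using contDiff_snd
  · simp only [Fin.snoc_castSucc]
    fun_prop

lemma contDiff_front_last (k : ℕ) : ContDiff ℂ 1
    fun z : Fin (k + 1) → ℂ => ((Fin.init z : Fin k → ℂ), z (Fin.last k)) := by
  unfold Fin.init
  fun_prop

/-! ### Complex marginals -/

/-- The vector with first entries `x` and remaining entries `t`. -/
def merge {α : Type*} {d k : ℕ} (x : Fin k → α) (t : {i : Fin d // k ≤ i.val} → α) : Fin d → α :=
  fun i => if h : i.val < k then x ⟨i.val, h⟩ else t ⟨i, not_lt.mp h⟩

lemma merge_mem_cube {d k : ℕ} {x : Fin k → ℝ} {t : {i : Fin d // k ≤ i.val} → ℝ}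
    (hx : x ∈ cube _) (ht : t ∈ cube _) : merge x t ∈ cube (Fin d) := by
  intro i
  unfold merge
  split_ifs with h
  exacts [hx _, ht _]

lemma toComplex_merge {d k : ℕ} (x : Fin k → ℝ) (t : {i : Fin d // k ≤ i.val} → ℝ) :
    toComplex (merge x t) = merge (toComplex x) (toComplex t) := by
  ext i
  by_cases h : i.val < k <;> simp [merge, toComplex, h]

lemma merge_mem_polystrip {d k : ℕ} {δ : Fin d → ℝ} (hδ : ∀ i, 0 < δ i) (hk : k ≤ d)
    {z : Fin k → ℂ} (hz : z ∈ polystrip (head δ hk)) {t : {i : Fin d // k ≤ i.val} → ℝ}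
    (ht : t ∈ cube _) : merge z (toComplex t) ∈ polystrip δ := by
  intro i
  unfold merge
  split_ifs with h
  · exact hz ⟨i, h⟩
  · exact ofReal_mem_strip (hδ i) (ht _)

/-- The marginal of a function on a polystrip in its first `k` variables. -/
def complexMarginal {d : ℕ} (g : (Fin d → ℂ) → ℂ) (k : ℕ) (z : Fin k → ℂ) : ℂ :=
  ∫ t, g (merge z (toComplex t)) ∂mu {i : Fin d // k ≤ i.val}

section Marginal

variable {d : ℕ} {M L C : ℝ} {δ : Fin d → ℝ} {f : (Fin d → ℝ) → ℝ} {g : (Fin d → ℂ) → ℂ}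

/-- Puts the integrand of a marginal in the form required by `contDiffOn_one_setIntegral_affine`. -/
lemma merge_eq_affine {k : ℕ} (z : Fin k → ℂ) (t : {i : Fin d // k ≤ i.val} → ℂ) :
    merge z t = ContinuousLinearMap.pi (R := ℂ) (fun i : Fin d => if h : i.val < k then
      ContinuousLinearMap.proj (R := ℂ) (φ := fun _ : Fin k => ℂ) ⟨i.val, h⟩ else 0) z +
      merge 0 t := by
  ext i
  by_cases h : i.val < k <;> simp [merge, h]

lemma continuous_merge_right {k : ℕ} (z : Fin k → ℂ) :
    Continuous fun t : {i : Fin d // k ≤ i.val} → ℝ => (merge z (toComplex t) : Fin d → ℂ) := by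
  refine continuous_pi fun i => ?_
  by_cases h : i.val < k
  · simpa [merge, h] using continuous_const
  · simp only [merge, h, toComplex, dite_false]
    fun_prop

lemma contDiffOn_complexMarginal (hδ : ∀ i, 0 < δ i) (hg : ContDiffOn ℂ 1 g (polystrip δ))
    {k : ℕ} (hk : k ≤ d) :
    ContDiffOn ℂ 1 (complexMarginal g k) (polystrip (head δ hk)) := by
  have := contDiffOn_one_setIntegral_affine (isOpen_polystrip (head δ hk)) isCompact_cube
    (mu {i : Fin d // k ≤ i.val}) (isOpen_polystrip δ) hg
    (A := fun _ => ContinuousLinearMap.pi (R := ℂ) (fun i : Fin d => if h : i.val < k then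
      ContinuousLinearMap.proj (R := ℂ) (φ := fun _ : Fin k => ℂ) ⟨i.val, h⟩ else 0))
    (b := fun t => merge 0 (toComplex t)) continuous_const (continuous_merge_right 0) (by
      intro z hz t ht
      rw [← merge_eq_affine]
      exact merge_mem_polystrip hδ hk hz ht)
  simp only [← merge_eq_affine, restrict_mu_cube] at this
  exact this

lemma integrable_comp_merge (hδ : ∀ i, 0 < δ i) (hg : ContinuousOn g (polystrip δ)) {k : ℕ}
    (hk : k ≤ d) {z : Fin k → ℂ} (hz : z ∈ polystrip (head δ hk)) :
    Integrable (fun t => g (merge z (toComplex t))) (mu {i : Fin d // k ≤ i.val}) := by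
  rw [← restrict_mu_cube]
  exact (hg.comp (continuous_merge_right z).continuousOn
    fun t ht => merge_mem_polystrip hδ hk hz ht).integrableOn_compact isCompact_cube

lemma norm_complexMarginal_sub_le (hδ : ∀ i, 0 < δ i) (hg : ContinuousOn g (polystrip δ)) {k : ℕ}
    (hk : k ≤ d) {z w : Fin k → ℂ} (hz : z ∈ polystrip (head δ hk))
    (hw : w ∈ polystrip (head δ hk)) {B : ℝ} (hB : ∀ t ∈ cube {i : Fin d // k ≤ i.val},
      ‖g (merge z (toComplex t)) - g (merge w (toComplex t))‖ ≤ B) :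
    ‖complexMarginal g k z - complexMarginal g k w‖ ≤ B := by
  unfold complexMarginal
  rw [← integral_sub (integrable_comp_merge hδ hg hk hz) (integrable_comp_merge hδ hg hk hw)]
  refine (norm_integral_le_of_norm_le_const (ae_mem_cube.mono hB)).trans ?_
  simp

lemma norm_complexMarginal_le (hδ : ∀ i, 0 < δ i) {k : ℕ} (hk : k ≤ d)
    (hL : ∀ z ∈ polystrip δ, ‖g z‖ ≤ L) {z : Fin k → ℂ} (hz : z ∈ polystrip (head δ hk)) :
    ‖complexMarginal g k z‖ ≤ L := by
  refine (norm_integral_le_of_norm_le_const (C := L) (ae_mem_cube.mono fun t ht =>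
    hL _ (merge_mem_polystrip hδ hk hz ht))).trans ?_
  simp

lemma complexMarginal_toComplex (hext : ∀ x ∈ cube (Fin d), g (toComplex x) = (f x : ℂ)) {k : ℕ}
    {x : Fin k → ℝ} (hx : x ∈ cube (Fin k)) :
    complexMarginal g k (toComplex x) = (marginal f k x : ℂ) := by
  unfold complexMarginal marginal
  rw [← integral_complex_ofReal]
  refine integral_congr_ae (ae_mem_cube.mono fun t ht => ?_)
  simp only
  rw [← toComplex_merge, hext _ (merge_mem_cube hx ht)]
  rfl

/-- Inserting a value at index `k` in front of a vector indexed by the indices above `k`. -/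
def insertAt {k : ℕ} (p : ℝ × ({i : Fin d // k + 1 ≤ i.val} → ℝ)) (i : {i : Fin d // k ≤ i.val}) :
    ℝ :=
  if h : i.1.val = k then p.1 else p.2 ⟨i.1, Nat.succ_le_of_lt (lt_of_le_of_ne i.2 (Ne.symm h))⟩

lemma merge_insertAt {k : ℕ} (z : Fin k → ℂ) (p : ℝ × ({i : Fin d // k + 1 ≤ i.val} → ℝ)) :
    merge z (toComplex (insertAt p)) =
      merge (Fin.snoc (α := fun _ => ℂ) z (p.1 : ℂ) : Fin (k + 1) → ℂ) (toComplex p.2) := by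
  ext i
  rcases lt_trichotomy i.val k with h | h | h
  · simp [merge, h, Nat.lt_succ_of_lt h, Fin.snoc]
  · simp [merge, h, Fin.snoc, insertAt, toComplex]
  · simp [merge, not_lt.2 h.le, not_lt.2 (Nat.succ_le_of_lt h), insertAt, toComplex, h.ne']

lemma measurePreserving_insertAt {k : ℕ} (hk : k < d) :
    MeasurePreserving (insertAt (d := d) (k := k))
      (mu₁.prod (mu {i : Fin d // k + 1 ≤ i.val})) (mu {i : Fin d // k ≤ i.val}) := by
  have hmeas : Measurable (insertAt (d := d) (k := k)) := by
    refine measurable_pi_lambda _ fun i => ?_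
    unfold insertAt
    split_ifs <;> fun_prop
  refine ⟨hmeas, ?_⟩
  symm
  refine Measure.pi_eq fun s hs => ?_
  rw [Measure.map_apply hmeas (MeasurableSet.univ_pi hs)]
  let i₀ : {i : Fin d // k ≤ i.val} := ⟨⟨k, hk⟩, le_rfl⟩
  let e : {i : Fin d // k + 1 ≤ i.val} → {i : Fin d // k ≤ i.val} :=
    fun i => ⟨i.1, (Nat.le_succ k).trans i.2⟩
  have hpre : insertAt ⁻¹' (univ.pi s) = s i₀ ×ˢ univ.pi fun i => s (e i) := by
    ext p
    simp only [mem_preimage, mem_univ_pi, mem_prod]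
    constructor
    · intro h
      refine ⟨by simpa [insertAt, i₀] using h i₀, fun i => ?_⟩
      have := h (e i)
      rwa [insertAt, dif_neg (by have := i.2; simp only [e]; omega)] at this
    · rintro ⟨h1, h2⟩ i
      by_cases h : i.1.val = k
      · have : i = i₀ := Subtype.ext (Fin.ext h)
        subst this
        simpa [insertAt, i₀] using h1
      · rw [insertAt, dif_neg h]
        exact h2 ⟨i.1, _⟩
  rw [hpre, Measure.prod_prod, mu, Measure.pi_pi, Fintype.prod_eq_mul_prod_compl i₀]
  congr 1
  refine Finset.prod_bij (fun i _ => e i) ?_ ?_ ?_ ?_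
  · intro i _
    simp only [Finset.mem_compl, Finset.mem_singleton, e, i₀, Subtype.mk.injEq]
    intro h
    have := i.2
    rw [h] at this
    simp at this
  · intro i _ j _ h
    simpa [e, Subtype.ext_iff] using h
  · intro j hj
    simp only [Finset.mem_compl, Finset.mem_singleton] at hj
    refine ⟨⟨j.1, Nat.succ_le_of_lt (lt_of_le_of_ne j.2 fun h => hj ?_)⟩, Finset.mem_univ _, rfl⟩
    exact Subtype.ext (Fin.ext h.symm)
  · intro i _
    rfl

/-- Fubini, after splitting off the variable of index `k`. It keeps conditional densities normalized
at complex parameters. -/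
lemma integral_complexMarginal_succ (hδ : ∀ i, 0 < δ i) (hg : ContinuousOn g (polystrip δ))
    {k : ℕ} (hk : k < d) {z : Fin k → ℂ} (hz : z ∈ polystrip (head δ hk.le)) :
    ∫ s, complexMarginal g (k + 1) (Fin.snoc (α := fun _ => ℂ) z (s : ℂ)) ∂mu₁ =
      complexMarginal g k z := by
  have hmp := measurePreserving_insertAt hk
  have hint := integrable_comp_merge hδ hg hk.le hz
  have hint' : Integrable (fun p : ℝ × ({i : Fin d // k + 1 ≤ i.val} → ℝ) =>
      g (merge z (toComplex (insertAt p)))) (mu₁.prod (mu _)) := hmp.integrable_comp_of_integrable hint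
  conv_rhs => rw [complexMarginal, ← hmp.map_eq]
  rw [integral_map hmp.measurable.aemeasurable (by rw [hmp.map_eq]; exact hint.1),
    integral_prod _ hint']
  simp only [merge_insertAt]
  rfl

end Marginal

/-! ### Complex conditional densities -/

/-- The extension of `condDensity` to complex arguments. -/
def complexCond {d : ℕ} (g : (Fin d → ℂ) → ℂ) (k : ℕ) (z : Fin k → ℂ) (s : ℂ) : ℂ :=
  complexMarginal g (k + 1) (Fin.snoc (α := fun _ => ℂ) z s) / complexMarginal g k z

/-- The perturbed denominator keeps modulus at least `M / 2`, while the numerator of the difference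
is at most `ε (‖b₀‖ + L) ≤ 2 (L / M) ε ‖b₀‖`. Dividing gives the factor `4L / M²`. -/
lemma norm_div_sub_div_le {M L ε : ℝ} (hM : 0 < M) (hε : ε ≤ M / 2) {a b a₀ b₀ : ℂ}
    (ha₀ : ‖a₀‖ ≤ L) (hb₀ : M ≤ ‖b₀‖) (hML : M ≤ L) (ha : ‖a - a₀‖ ≤ ε) (hb : ‖b - b₀‖ ≤ ε) :
    ‖a / b - a₀ / b₀‖ ≤ 4 * L / M ^ 2 * ε := by
  have hε0 : 0 ≤ ε := (norm_nonneg _).trans ha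
  have hbn : M / 2 ≤ ‖b‖ := by
    have := norm_sub_norm_le b₀ b
    rw [norm_sub_rev] at this
    linarith
  have hb0 : b ≠ 0 := norm_pos_iff.1 (by linarith)
  have hb₀0 : b₀ ≠ 0 := norm_pos_iff.1 (by linarith)
  have heq : a / b - a₀ / b₀ = ((a - a₀) * b₀ - a₀ * (b - b₀)) / (b * b₀) := by
    field_simp
    ring
  have hB : 0 < ‖b₀‖ := by linarith
  rw [heq, norm_div, norm_mul, div_le_iff₀ (by positivity)]
  have h1 : ‖(a - a₀) * b₀ - a₀ * (b - b₀)‖ ≤ ε * ‖b₀‖ + L * ε := by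
    refine (norm_sub_le _ _).trans ?_
    rw [norm_mul, norm_mul]
    gcongr
    linarith
  have h2 : 4 * L / M ^ 2 * ε * (M / 2 * ‖b₀‖) ≤ 4 * L / M ^ 2 * ε * (‖b‖ * ‖b₀‖) := by
    have : 0 ≤ L := by linarith
    gcongr
  have h3 : 4 * L / M ^ 2 * ε * (M / 2 * ‖b₀‖) = 2 * L / M * ε * ‖b₀‖ := by
    field_simp
    ring
  have h4 : ε * ‖b₀‖ + L * ε ≤ 2 * L / M * ε * ‖b₀‖ := by
    have h5 : ε * ‖b₀‖ ≤ L / M * ε * ‖b₀‖ := by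
      rw [mul_assoc]
      exact le_mul_of_one_le_left (by positivity) ((one_le_div hM).2 hML)
    have h6 : L * ε ≤ L / M * ε * ‖b₀‖ := by
      calc L * ε = L / M * ε * M := by field_simp
        _ ≤ _ := by
          have : 0 ≤ L := by linarith
          gcongr
    calc _ ≤ L / M * ε * ‖b₀‖ + L / M * ε * ‖b₀‖ := add_le_add h5 h6
      _ = _ := by ring
  linarith

/-! ### Marginals and conditional densities under the density assumption -/

namespace DensityAssumption

variable {d : ℕ} {M L C : ℝ} {δ : Fin d → ℝ} {f : (Fin d → ℝ) → ℝ} {g : (Fin d → ℂ) → ℂ}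

/-- On the cube the density is positive, so it equals its modulus and the lower bound survives
averaging. At complex points cancellation could destroy it, so there lower bounds come from
comparison with a nearby real point. -/
lemma le_marginal (h : DensityAssumption M L C δ f g) (hδ : ∀ i, 0 < δ i) {k : ℕ} (hk : k ≤ d)
    {x : Fin k → ℝ} (hx : x ∈ cube (Fin k)) : M ≤ marginal f k x := by
  have hxp := toComplex_mem_polystrip (δ := head δ hk) (fun i => hδ _) hx
  have hint := integrable_comp_merge hδ h.contDiffOn.continuousOn hk hxp
  have hae : ∀ᵐ t ∂mu {i : Fin d // k ≤ i.val},
      g (merge (toComplex x) (toComplex t)) = (f (merge x t) : ℂ) :=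
    ae_mem_cube.mono fun t ht => by
      rw [← toComplex_merge, h.extends_f _ (merge_mem_cube hx ht)]
  have hint' : Integrable (fun t => f (merge x t)) (mu {i : Fin d // k ≤ i.val}) := by
    have := (hint.congr hae).re
    simpa using this
  have h1 : ∫ _ : {i : Fin d // k ≤ i.val} → ℝ, M ∂mu _ ≤ ∫ t, f (merge x t) ∂mu _ := by
    refine integral_mono_ae (integrable_const _) hint' (ae_mem_cube.mono fun t ht => ?_)
    have hm := merge_mem_cube hx ht
    have := (h.bounds _ (toComplex_mem_polystrip hδ hm)).1
    rwa [h.extends_f _ hm, Complex.norm_real, Real.norm_of_nonneg (h.density.pos _ hm).le] at this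
  rw [integral_const, probReal_univ, one_smul] at h1
  exact h1

lemma marginal_le (h : DensityAssumption M L C δ f g) (hδ : ∀ i, 0 < δ i) {k : ℕ} (hk : k ≤ d)
    {x : Fin k → ℝ} (hx : x ∈ cube (Fin k)) : marginal f k x ≤ L := by
  have := norm_complexMarginal_le hδ hk (fun z hz => (h.bounds z hz).2)
    (toComplex_mem_polystrip (δ := head δ hk) (fun i => hδ _) hx)
  rw [complexMarginal_toComplex h.extends_f hx, Complex.norm_real] at this
  exact (le_abs_self _).trans this

/-- The variation of a marginal over a polystrip is controlled by `C`. -/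
lemma norm_complexMarginal_sub_le (h : DensityAssumption M L C δ f g) (hδ : ∀ i, 0 < δ i) {k : ℕ}
    (hk : k ≤ d) {z : Fin k → ℂ} {x : Fin k → ℝ} (hx : x ∈ cube (Fin k))
    (hz : ∀ i, ‖z i - x i‖ < head δ hk i) :
    ‖complexMarginal g k z - complexMarginal g k (toComplex x)‖ ≤ C := by
  refine KnotheRosenblatt.norm_complexMarginal_sub_le hδ h.contDiffOn.continuousOn hk
    (mem_polystrip_of_norm_sub_lt hx hz)
    (toComplex_mem_polystrip (fun i => hδ _) hx) fun t ht => ?_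
  have := h.small _ (merge_mem_cube hx ht) (merge z (toComplex t) - toComplex (merge x t)) (by
    intro i
    rw [toComplex_merge]
    by_cases hi : i.val < k
    · simp only [Pi.sub_apply, merge, hi, dite_true]
      exact hz ⟨i, hi⟩
    · simpa [merge, hi] using hδ i)
  rwa [add_sub_cancel, toComplex_merge] at this

/-- The variation of a marginal over complex perturbations of variables before the `j`-th one. -/
lemma norm_complexMarginal_sub_le_mul (h : DensityAssumption M L C δ f g) (hδ : ∀ i, 0 < δ i)
    {k : ℕ} (hk : k ≤ d) {z : Fin k → ℂ} {x : Fin k → ℝ} (hx : x ∈ cube (Fin k))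
    (hz : ∀ i, ‖z i - x i‖ < head δ hk i) {j : Fin d} (hj : 1 ≤ j.val)
    (hzj : ∀ i : Fin k, j.val ≤ i.val → z i = x i) :
    ‖complexMarginal g k z - complexMarginal g k (toComplex x)‖ ≤ C * δ j := by
  refine KnotheRosenblatt.norm_complexMarginal_sub_le hδ h.contDiffOn.continuousOn hk
    (mem_polystrip_of_norm_sub_lt hx hz)
    (toComplex_mem_polystrip (fun i => hδ _) hx) fun t ht => ?_
  have := h.small_partial _ (merge_mem_cube hx ht) j hj
    (merge z (toComplex t) - toComplex (merge x t)) (by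
    intro i _
    rw [toComplex_merge]
    by_cases hi : i.val < k
    · simp only [Pi.sub_apply, merge, hi, dite_true]
      exact hz ⟨i, hi⟩
    · simpa [merge, hi] using hδ i) (by
    intro i hij
    rw [toComplex_merge]
    by_cases hi : i.val < k
    · simpa [merge, hi, toComplex, sub_eq_zero] using hzj ⟨i, hi⟩ hij
    · simp [merge, hi])
  rwa [add_sub_cancel, toComplex_merge] at this

lemma complexMarginal_ne_zero (h : DensityAssumption M L C δ f g) (hδ : ∀ i, 0 < δ i)
    (hC : C < M) {k : ℕ} (hk : k ≤ d) {z : Fin k → ℂ} (hz : z ∈ polystrip (head δ hk)) :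
    complexMarginal g k z ≠ 0 := by
  obtain ⟨x, hx, hxz⟩ := exists_cube_of_mem_polystrip hz
  have h1 := h.norm_complexMarginal_sub_le hδ hk hx hxz
  rw [complexMarginal_toComplex h.extends_f hx] at h1
  intro h0
  rw [h0, zero_sub, norm_neg, Complex.norm_real] at h1
  have := h.le_marginal hδ hk hx
  have := le_abs_self (marginal f k x)
  rw [Real.norm_eq_abs] at h1
  linarith

lemma contDiffOn_complexCond (h : DensityAssumption M L C δ f g) (hδ : ∀ i, 0 < δ i)
    (hC : C < M) {k : ℕ} (hk : k < d) :
    ContDiffOn ℂ 1 (fun p : (Fin k → ℂ) × ℂ => complexCond g k p.1 p.2)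
      (polystrip (head δ hk.le) ×ˢ strip (δ ⟨k, hk⟩)) := by
  have h1 := (contDiffOn_complexMarginal hδ h.contDiffOn (Nat.succ_le_of_lt hk)).comp
    (s := polystrip (head δ hk.le) ×ˢ strip (δ ⟨k, hk⟩)) (contDiff_snoc k).contDiffOn
    fun p hp => snoc_mem_polystrip hk hp.1 hp.2
  have h2 := (contDiffOn_complexMarginal hδ h.contDiffOn hk.le).comp
    (s := polystrip (head δ hk.le) ×ˢ strip (δ ⟨k, hk⟩)) contDiff_fst.contDiffOn fun p hp => hp.1
  exact h1.div h2 fun p hp => h.complexMarginal_ne_zero hδ hC hk.le hp.1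

lemma differentiableOn_complexCond (h : DensityAssumption M L C δ f g) (hδ : ∀ i, 0 < δ i)
    (hC : C < M) {k : ℕ} (hk : k < d) {z : Fin k → ℂ} (hz : z ∈ polystrip (head δ hk.le)) :
    DifferentiableOn ℂ (complexCond g k z) (strip (δ ⟨k, hk⟩)) :=
  ((h.contDiffOn_complexCond hδ hC hk).differentiableOn one_ne_zero).comp
    (f := fun s => (z, s)) (by fun_prop) fun _ hs => ⟨hz, hs⟩

lemma complexCond_toComplex (h : DensityAssumption M L C δ f g) {k : ℕ} {x : Fin k → ℝ}
    (hx : x ∈ cube (Fin k)) {t : ℝ} (ht : t ∈ Icc (-1 : ℝ) 1) :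
    complexCond g k (toComplex x) t =
      (condDensity f k (Fin.snoc (α := fun _ => ℝ) x t) : ℂ) := by
  rw [complexCond, ← toComplex_snoc, complexMarginal_toComplex h.extends_f (snoc_mem_cube hx ht),
    complexMarginal_toComplex h.extends_f hx, condDensity, Fin.init_snoc, Complex.ofReal_div]

lemma condDensity_mem_Icc (h : DensityAssumption M L C δ f g) (hδ : ∀ i, 0 < δ i) (hM : 0 < M)
    {k : ℕ} (hk : k < d) {x : Fin (k + 1) → ℝ} (hx : x ∈ cube (Fin (k + 1))) :
    condDensity f k x ∈ Icc (M / L) (L / M) := by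
  have hx' : (Fin.init x : Fin k → ℝ) ∈ cube (Fin k) := fun i => hx _
  have h1 := h.le_marginal hδ (Nat.succ_le_of_lt hk) hx
  have h2 := h.marginal_le hδ (Nat.succ_le_of_lt hk) hx
  have h3 := h.le_marginal hδ hk.le hx'
  have h4 := h.marginal_le hδ hk.le hx'
  unfold condDensity
  constructor
  · exact div_le_div₀ (by linarith) h1 (by linarith) h4
  · exact div_le_div₀ (by linarith) h2 hM h3

lemma norm_complexCond_sub_le (h : DensityAssumption M L C δ f g) (hδ : ∀ i, 0 < δ i) (hM : 0 < M)
    (hML : M ≤ L) (hC : C ≤ M / 2) {k : ℕ} (hk : k < d) {z : Fin k → ℂ} {x : Fin k → ℝ}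
    (hx : x ∈ cube (Fin k)) (hz : ∀ i, ‖z i - x i‖ < head δ hk.le i) {s : ℂ} {t : ℝ}
    (ht : t ∈ Icc (-1 : ℝ) 1) (hs : ‖s - t‖ < δ ⟨k, hk⟩) :
    ‖complexCond g k z s - complexCond g k (toComplex x) t‖ ≤ 4 * L / M ^ 2 * C := by
  have hxt := snoc_mem_cube hx ht
  refine norm_div_sub_div_le hM hC ?_ ?_ hML ?_ (h.norm_complexMarginal_sub_le hδ hk.le hx hz)
  · rw [← toComplex_snoc]
    exact norm_complexMarginal_le hδ (Nat.succ_le_of_lt hk) (fun z hz => (h.bounds z hz).2)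
      (toComplex_mem_polystrip (fun i => hδ _) hxt)
  · rw [complexMarginal_toComplex h.extends_f hx, Complex.norm_real]
    exact (h.le_marginal hδ hk.le hx).trans (le_abs_self _)
  · rw [← toComplex_snoc]
    refine h.norm_complexMarginal_sub_le hδ (Nat.succ_le_of_lt hk) hxt fun i => ?_
    refine Fin.lastCases ?_ (fun j => ?_) i
    · simp only [Fin.snoc_last]
      exact hs
    · simp only [Fin.snoc_castSucc]
      exact hz j

/-- Only the earlier variables are perturbed, so `small` and `small_partial` both apply. The first
gives the bound `C`, the second `C * δ k`. -/
lemma norm_complexCond_sub_le_min (h : DensityAssumption M L C δ f g) (hδ : ∀ i, 0 < δ i)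
    (hM : 0 < M) (hML : M ≤ L) (hC0 : 0 ≤ C) (hC : C ≤ M / 2) {k : ℕ} (hk : k < d)
    {z : Fin k → ℂ} {x : Fin k → ℝ}
    (hx : x ∈ cube (Fin k)) (hz : ∀ i, ‖z i - x i‖ < head δ hk.le i) {t : ℝ}
    (ht : t ∈ Icc (-1 : ℝ) 1) :
    ‖complexCond g k z t - complexCond g k (toComplex x) t‖ ≤
      4 * L / M ^ 2 * (C * min 1 (δ ⟨k, hk⟩)) := by
  have hL : 0 < L := hM.trans_le hML
  have hmin : 0 ≤ min 1 (δ ⟨k, hk⟩) := le_min zero_le_one (hδ _).le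
  -- `small_partial` needs a positive index; for `k = 0` there is no earlier variable and the
  -- difference vanishes.
  rcases Nat.eq_zero_or_pos k with rfl | hk0
  · rw [Subsingleton.elim z (toComplex x), sub_self, norm_zero]
    positivity
  have hxt := snoc_mem_cube hx ht
  have hzt : ∀ i, ‖(Fin.snoc (α := fun _ => ℂ) z (t : ℂ) : Fin (k + 1) → ℂ) i -
      (Fin.snoc (α := fun _ => ℝ) x t : Fin (k + 1) → ℝ) i‖ < head δ (Nat.succ_le_of_lt hk) i := by
    intro i
    refine Fin.lastCases ?_ (fun j => ?_) i
    · simp only [Fin.snoc_last, sub_self, norm_zero]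
      exact hδ _
    · simp only [Fin.snoc_castSucc]
      exact hz j
  have hb : C * min 1 (δ ⟨k, hk⟩) ≤ M / 2 :=
    (mul_le_of_le_one_right hC0 (min_le_left _ _)).trans hC
  have key : ∀ a : ℝ, a ≤ C → a ≤ C * δ ⟨k, hk⟩ → a ≤ C * min 1 (δ ⟨k, hk⟩) := by
    intro a h1 h2
    rw [mul_min_of_nonneg _ _ hC0, mul_one]
    exact le_min h1 h2
  refine norm_div_sub_div_le hM hb ?_ ?_ hML (key _ ?_ ?_) (key _ ?_ ?_)
  · rw [← toComplex_snoc]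
    exact norm_complexMarginal_le hδ (Nat.succ_le_of_lt hk) (fun z hz => (h.bounds z hz).2)
      (toComplex_mem_polystrip (fun i => hδ _) hxt)
  · rw [complexMarginal_toComplex h.extends_f hx, Complex.norm_real]
    exact (h.le_marginal hδ hk.le hx).trans (le_abs_self _)
  · rw [← toComplex_snoc]
    exact h.norm_complexMarginal_sub_le hδ (Nat.succ_le_of_lt hk) hxt hzt
  · rw [← toComplex_snoc]
    -- Among the `k + 1` variables of the numerator only the last has index at least `k`, and it is
    -- kept real.
    refine h.norm_complexMarginal_sub_le_mul hδ (Nat.succ_le_of_lt hk) hxt hzt hk0 fun i hi => ?_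
    have : i = Fin.last k := Fin.ext (le_antisymm (Nat.lt_succ_iff.1 i.2) hi)
    subst this
    simp
  · exact h.norm_complexMarginal_sub_le hδ hk.le hx hz
  · exact h.norm_complexMarginal_sub_le_mul hδ hk.le hx hz hk0
      fun i hi => absurd i.2 (not_lt.2 hi)

lemma halfPrimitive_complexCond_one (h : DensityAssumption M L C δ f g) (hδ : ∀ i, 0 < δ i)
    (hC : C < M) {k : ℕ} (hk : k < d) {z : Fin k → ℂ} (hz : z ∈ polystrip (head δ hk.le)) :
    halfPrimitive (complexCond g k z) 1 = 1 := by
  have h1 := halfPrimitive_ofReal (hδ ⟨k, hk⟩) (h.differentiableOn_complexCond hδ hC hk hz)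
    (t := 1) (by norm_num)
  rw [← integral_mu₁] at h1
  simp only [complexCond, integral_div, Complex.ofReal_one,
    integral_complexMarginal_succ hδ h.contDiffOn.continuousOn hk hz] at h1
  rw [div_self (h.complexMarginal_ne_zero hδ hC hk.le hz)] at h1
  exact h1

lemma halfPrimitive_complexCond_toComplex (h : DensityAssumption M L C δ f g)
    (hδ : ∀ i, 0 < δ i) (hC : C < M) {k : ℕ} (hk : k < d) {x : Fin k → ℝ}
    (hx : x ∈ cube (Fin k)) {t : ℝ} (ht : t ∈ Icc (-1 : ℝ) 1) :
    halfPrimitive (complexCond g k (toComplex x)) t = (condCDF f k x t : ℂ) := by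
  rw [halfPrimitive_ofReal (hδ ⟨k, hk⟩) (h.differentiableOn_complexCond hδ hC hk
    (toComplex_mem_polystrip (fun i => hδ _) hx)) ht, condCDF]
  push_cast
  rw [← intervalIntegral.integral_ofReal]
  congr 1
  refine intervalIntegral.integral_congr fun τ hτ => ?_
  rw [uIcc_of_le ht.1] at hτ
  exact h.complexCond_toComplex hx ⟨hτ.1, hτ.2.trans ht.2⟩

end DensityAssumption

namespace DensityAssumption

variable {d : ℕ} {M L C : ℝ} {δ : Fin d → ℝ} {f : (Fin d → ℝ) → ℝ} {g : (Fin d → ℂ) → ℂ}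

/-! ### Bounds for conditional densities and distribution functions -/

/-- Each value is within `M / (4L)` of a real value in `[M / L, L / M]`. The imaginary part is
recorded for the real part of quotients in `norm_div_sub_one_le_and_re`. -/
lemma complexCond_bounds (h : DensityAssumption M L C δ f g) (hδ : ∀ i, 0 < δ i) (hM : 0 < M)
    (hML : M ≤ L) (hC : C ≤ M / 2) (hC' : 4 * L / M ^ 2 * C ≤ M / (4 * L)) {k : ℕ} (hk : k < d)
    {z : Fin k → ℂ} (hz : z ∈ polystrip (head δ hk.le)) {s : ℂ} (hs : s ∈ strip (δ ⟨k, hk⟩)) :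
    ‖complexCond g k z s‖ ≤ 2 * (L / M) ∧ M / (2 * L) ≤ (complexCond g k z s).re ∧
      |(complexCond g k z s).im| ≤ M / (4 * L) := by
  have hL : 0 < L := hM.trans_le hML
  obtain ⟨x, hx, hxz⟩ := exists_cube_of_mem_polystrip hz
  obtain ⟨t, ht, hst⟩ := mem_strip_iff.1 hs
  have h1 := (h.norm_complexCond_sub_le hδ hM hML hC hk hx hxz ht hst).trans hC'
  rw [h.complexCond_toComplex hx ht] at h1
  obtain ⟨h2, h3⟩ := h.condDensity_mem_Icc hδ hM hk (snoc_mem_cube hx ht)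
  generalize condDensity f k (Fin.snoc (α := fun _ => ℝ) x t) = y at h1 h2 h3
  have hle : M / (4 * L) ≤ L / M := by
    rw [div_le_div_iff₀ (by positivity) hM]
    nlinarith
  have hy : 0 ≤ y := le_trans (by positivity) h2
  refine ⟨?_, ?_, ?_⟩
  · have := norm_le_norm_add_norm_sub (y : ℂ) (complexCond g k z s)
    rw [Complex.norm_real, Real.norm_of_nonneg hy, norm_sub_rev] at this
    linarith
  · have h4 := (abs_le.1 ((Complex.abs_re_le_norm _).trans h1)).1
    rw [Complex.sub_re, Complex.ofReal_re] at h4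
    have h5 : M / L - M / (4 * L) = 3 / 2 * (M / (2 * L)) := by
      field_simp
      ring
    have h6 : 0 < M / (2 * L) := by positivity
    linarith
  · have := (Complex.abs_im_le_norm _).trans h1
    simpa using this

/-- The interval has length at most `2`, which the factor `1 / 2` cancels, so the bound for the
densities carries over unchanged. -/
lemma norm_halfPrimitive_sub_le (h : DensityAssumption M L C δ f g) (hδ : ∀ i, 0 < δ i)
    (hM : 0 < M) (hML : M ≤ L) (hC0 : 0 ≤ C) (hC : C ≤ M / 2) {k : ℕ} (hk : k < d)
    {z : Fin k → ℂ} {x : Fin k → ℝ}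
    (hx : x ∈ cube (Fin k)) (hz : ∀ i, ‖z i - x i‖ < head δ hk.le i) {t : ℝ}
    (ht : t ∈ Icc (-1 : ℝ) 1) :
    ‖halfPrimitive (complexCond g k z) t - halfPrimitive (complexCond g k (toComplex x)) t‖ ≤
      4 * L / M ^ 2 * (C * min 1 (δ ⟨k, hk⟩)) := by
  have hCM : C < M := by linarith
  have hd1 := h.differentiableOn_complexCond hδ hCM hk (mem_polystrip_of_norm_sub_lt hx hz)
  have hd2 := h.differentiableOn_complexCond hδ hCM hk
    (toComplex_mem_polystrip (δ := head δ hk.le) (fun i => hδ _) hx)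
  have hsub : ∀ τ ∈ uIcc (-1 : ℝ) t, τ ∈ Icc (-1 : ℝ) 1 := by
    intro τ hτ
    rw [uIcc_of_le ht.1] at hτ
    exact ⟨hτ.1, hτ.2.trans ht.2⟩
  have hint : ∀ {φ : ℂ → ℂ}, DifferentiableOn ℂ φ (strip (δ ⟨k, hk⟩)) →
      IntervalIntegrable (fun τ : ℝ => φ τ) volume (-1) t := fun hφ =>
    ContinuousOn.intervalIntegrable (hφ.continuousOn.comp (by fun_prop)
      fun τ hτ => ofReal_mem_strip (hδ _) (hsub τ hτ))
  rw [halfPrimitive_ofReal (hδ ⟨k, hk⟩) hd1 ht, halfPrimitive_ofReal (hδ ⟨k, hk⟩) hd2 ht,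
    ← mul_sub, ← intervalIntegral.integral_sub (hint hd1) (hint hd2), norm_mul]
  have h1 := intervalIntegral.norm_integral_le_of_norm_le_const (a := (-1 : ℝ)) (b := t)
    (C := 4 * L / M ^ 2 * (C * min 1 (δ ⟨k, hk⟩)))
    (f := fun τ : ℝ => complexCond g k z τ - complexCond g k (toComplex x) τ) fun τ hτ =>
      h.norm_complexCond_sub_le_min hδ hM hML hC0 hC hk hx hz (hsub τ (uIoc_subset_uIcc hτ))
  have h2 : |t - -1| ≤ 2 := by
    rw [abs_of_nonneg (by linarith [ht.1])]
    linarith [ht.2]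
  have hL : 0 < L := hM.trans_le hML
  have h0 : 0 ≤ 4 * L / M ^ 2 * (C * min 1 (δ ⟨k, hk⟩)) := by
    have : 0 ≤ min 1 (δ ⟨k, hk⟩) := le_min zero_le_one (hδ _).le
    positivity
  have h3 : ‖(1 / 2 : ℂ)‖ = 1 / 2 := by norm_num
  rw [h3]
  have h4 := mul_le_mul_of_nonneg_left h2 h0
  linarith

lemma strictMonoOn_condCDF (h : DensityAssumption M L C δ f g) (hδ : ∀ i, 0 < δ i)
    (hM : 0 < M) (hML : M ≤ L) (hC : C ≤ M / 2) (hC' : 4 * L / M ^ 2 * C ≤ M / (4 * L))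
    {k : ℕ} (hk : k < d) {x : Fin k → ℝ} (hx : x ∈ cube (Fin k)) :
    StrictMonoOn (condCDF f k x) (Icc (-1) 1) ∧ ContinuousOn (condCDF f k x) (Icc (-1) 1) := by
  have hL : 0 < L := hM.trans_le hML
  have hCM : C < M := by linarith
  have hxp := toComplex_mem_polystrip (δ := head δ hk.le) (fun i => hδ _) hx
  let φ : ℝ → ℝ := fun t => (halfPrimitive (complexCond g k (toComplex x)) t).re
  have heq : EqOn φ (condCDF f k x) (Icc (-1) 1) := by
    intro t ht
    simp only [φ, h.halfPrimitive_complexCond_toComplex hδ hCM hk hx ht, Complex.ofReal_re]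
  have hd : ∀ t ∈ Icc (-1 : ℝ) 1,
      HasDerivAt φ ((complexCond g k (toComplex x) t / 2).re) t := fun t ht =>
    (hasDerivAt_halfPrimitive (hδ ⟨k, hk⟩) (h.differentiableOn_complexCond hδ hCM hk hxp)
      (ofReal_mem_strip (hδ _) ht)).real_of_complex
  have hcont : ContinuousOn φ (Icc (-1) 1) := fun t ht => (hd t ht).continuousAt.continuousWithinAt
  refine ⟨StrictMonoOn.congr ?_ heq, hcont.congr heq.symm⟩
  refine strictMonoOn_of_deriv_pos (convex_Icc _ _) hcont fun t ht => ?_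
  have ht' := interior_subset ht
  rw [(hd t ht').deriv]
  have h1 := (h.complexCond_bounds hδ hM hML hC hC' hk hxp (ofReal_mem_strip (hδ ⟨k, hk⟩) ht')).2.1
  have h2 : 0 < M / (2 * L) := by positivity
  have h3 : (complexCond g k (toComplex x) t / 2).re = (complexCond g k (toComplex x) t).re / 2 := by
    simp
  rw [h3]
  linarith

lemma condCDF_neg_one {k : ℕ} (x : Fin k → ℝ) : condCDF f k x (-1) = 0 := by simp [condCDF]

lemma condCDF_one (h : DensityAssumption M L C δ f g) (hδ : ∀ i, 0 < δ i) (hC : C < M)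
    {k : ℕ} (hk : k < d) {x : Fin k → ℝ} (hx : x ∈ cube (Fin k)) : condCDF f k x 1 = 1 := by
  have h1 := h.halfPrimitive_complexCond_toComplex hδ hC hk hx (t := 1) (by norm_num)
  rw [Complex.ofReal_one, h.halfPrimitive_complexCond_one hδ hC hk
    (toComplex_mem_polystrip (fun i => hδ _) hx)] at h1
  exact_mod_cast h1.symm

lemma bijOn_condCDF (h : DensityAssumption M L C δ f g) (hδ : ∀ i, 0 < δ i)
    (hM : 0 < M) (hML : M ≤ L) (hC : C ≤ M / 2) (hC' : 4 * L / M ^ 2 * C ≤ M / (4 * L))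
    {k : ℕ} (hk : k < d) {x : Fin k → ℝ} (hx : x ∈ cube (Fin k)) :
    BijOn (condCDF f k x) (Icc (-1) 1) (Icc 0 1) := by
  obtain ⟨hmono, hcont⟩ := h.strictMonoOn_condCDF hδ hM hML hC hC' hk hx
  have h0 : condCDF f k x (-1) = 0 := condCDF_neg_one x
  have h1 : condCDF f k x 1 = 1 := h.condCDF_one hδ (by linarith) hk hx
  have hmaps : MapsTo (condCDF f k x) (Icc (-1) 1) (Icc (condCDF f k x (-1)) (condCDF f k x 1)) :=
    fun t ht => ⟨hmono.monotoneOn (by norm_num) ht ht.1, hmono.monotoneOn ht (by norm_num) ht.2⟩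
  have hsurj := intermediate_value_Icc (by norm_num) hcont
  rw [h0, h1] at hmaps hsurj
  exact ⟨hmaps, hmono.injOn, hsurj⟩

/-- Near the real interval, a complex conditional density is within `O(1 / δ)` of `1`. -/
lemma norm_complexCond_sub_one_le (h : DensityAssumption M L C δ f g) (hδ : ∀ i, 0 < δ i)
    (hM : 0 < M) (hML : M ≤ L) (hC : C ≤ M / 2) (hC' : 4 * L / M ^ 2 * C ≤ M / (4 * L))
    {k : ℕ} (hk : k < d) {z : Fin k → ℂ} (hz : z ∈ polystrip (head δ hk.le)) {s : ℂ} {t : ℝ}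
    (ht : t ∈ Icc (-1 : ℝ) 1) (hst : ‖s - t‖ ≤ min 1 (δ ⟨k, hk⟩) / 2) :
    ‖complexCond g k z s - 1‖ ≤ 24 * (L / M) / δ ⟨k, hk⟩ := by
  have hCM : C < M := by linarith
  have hL : 0 < L := hM.trans_le hML
  set η := δ ⟨k, hk⟩
  have hη : 0 < η := hδ _
  have hdiff := h.differentiableOn_complexCond hδ hCM hk hz
  -- Cauchy estimate on discs of radius `η / 4`, which fit into the strip because `2/3 + 1/4 < 1`;
  -- the modulus is at most `2 (L / M)`.
  have hderiv : ∀ w ∈ strip (2 / 3 * η), ‖deriv (complexCond g k z) w‖ ≤ 8 * (L / M) / η := by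
    intro w hw
    obtain ⟨t, ht, hwt⟩ := mem_strip_iff.1 hw
    have hball : closedBall w (η / 4) ⊆ strip η := by
      intro v hv
      rw [mem_closedBall, dist_eq_norm] at hv
      refine mem_strip_iff.2 ⟨t, ht, ?_⟩
      have := norm_sub_le_norm_sub_add_norm_sub v w (t : ℂ)
      linarith
    have := Complex.norm_deriv_le_of_forall_mem_sphere_norm_le (by positivity)
      (hdiff.diffContOnCl_ball hball)
      fun v hv => (h.complexCond_bounds hδ hM hML hC hC' hk hz (hball (sphere_subset_closedBall hv))).1
    convert this using 1
    field_simp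
    ring
  have hsub : strip (2 / 3 * η) ⊆ strip η := thickening_mono (by linarith) _
  have hs1 : ‖s - t‖ ≤ 1 / 2 := hst.trans (by gcongr; exact min_le_left _ _)
  have hs2 : ‖s - t‖ ≤ η / 2 := hst.trans (by gcongr; exact min_le_right _ _)
  have hs : s ∈ strip (2 / 3 * η) := mem_strip_iff.2 ⟨t, ht, by linarith⟩
  have hclose : ∀ τ ∈ Icc (-1 : ℝ) 1,
      ‖complexCond g k z s - complexCond g k z τ‖ ≤ 24 * (L / M) / η := by
    intro τ hτ
    have h1 := (convex_strip (2 / 3 * η)).norm_image_sub_le_of_norm_deriv_le (f := complexCond g k z)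
      (fun w hw => hdiff.differentiableAt ((isOpen_strip η).mem_nhds (hsub hw))) hderiv
      (ofReal_mem_strip (by positivity) hτ) hs
    have h2 : ‖s - τ‖ ≤ 3 := by
      have h3 := norm_sub_le_norm_sub_add_norm_sub s t (τ : ℂ)
      have h4 : ‖(t : ℂ) - τ‖ ≤ 2 := by
        rw [← Complex.ofReal_sub, Complex.norm_real, Real.norm_eq_abs, abs_le]
        exact ⟨by linarith [ht.1, hτ.2], by linarith [ht.2, hτ.1]⟩
      linarith
    calc _ ≤ 8 * (L / M) / η * ‖s - τ‖ := h1
      _ ≤ 8 * (L / M) / η * 3 := by gcongr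
      _ = _ := by ring
  have hcont : ContinuousOn (fun τ : ℝ => complexCond g k z τ) (Icc (-1) 1) :=
    hdiff.continuousOn.comp (by fun_prop) fun τ hτ => ofReal_mem_strip hη hτ
  have hint : Integrable (fun τ : ℝ => complexCond g k z τ) mu₁ :=
    (hcont.integrableOn_compact isCompact_Icc).smul_measure (by simp)
  have hone : ∫ τ, complexCond g k z (τ : ℝ) ∂mu₁ = 1 := by
    have := halfPrimitive_ofReal hη hdiff (t := 1) (by norm_num)
    rw [integral_mu₁, ← this, Complex.ofReal_one, h.halfPrimitive_complexCond_one hδ hCM hk hz]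
  -- Since the mean over `[-1,1]` is `1`, the deviation from `1` is an average of differences
  -- already bounded by `hclose`.
  have heq : complexCond g k z s - 1 =
      ∫ τ, (complexCond g k z s - complexCond g k z (τ : ℝ)) ∂mu₁ := by
    rw [integral_sub (integrable_const _) hint, hone]
    simp
  rw [heq]
  refine (norm_integral_le_of_norm_le_const (ae_mem_Icc.mono hclose)).trans ?_
  simp

end DensityAssumption

/-! ### One step of the Knothe–Rosenblatt construction -/

section Step

variable {d : ℕ} {M L C : ℝ} {δ : Fin d → ℝ} {fρ fπ : (Fin d → ℝ) → ℝ} {gρ gπ : (Fin d → ℂ) → ℂ}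

/-- The value of a reference distribution function near the real interval is close to a value
on the real interval of the target distribution function. -/
lemma exists_near_solution (hρ : DensityAssumption M L C δ fρ gρ)
    (hπ : DensityAssumption M L C δ fπ gπ) (hδ : ∀ i, 0 < δ i) (hM : 0 < M) (hML : M ≤ L)
    (hC0 : 0 ≤ C) (hC : C ≤ M / 2) (hC' : 4 * L / M ^ 2 * C ≤ M / (4 * L)) {k : ℕ} (hk : k < d)
    {z w : Fin k → ℂ} (hz : z ∈ polystrip (head δ hk.le)) (hw : w ∈ polystrip (head δ hk.le))
    {s : ℂ} {t : ℝ} (ht : t ∈ Icc (-1 : ℝ) 1) (hst : ‖s - t‖ < δ ⟨k, hk⟩) :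
    ∃ t' ∈ Icc (-1 : ℝ) 1,
      ‖halfPrimitive (complexCond gρ k z) s - halfPrimitive (complexCond gπ k w) t'‖ ≤
        L / M * ‖s - t‖ + 2 * (4 * L / M ^ 2 * (C * min 1 (δ ⟨k, hk⟩))) := by
  have hCM : C < M := by linarith
  obtain ⟨x, hx, hxz⟩ := exists_cube_of_mem_polystrip hz
  obtain ⟨y, hy, hyw⟩ := exists_cube_of_mem_polystrip hw
  -- The real base points `x` and `y` are unrelated: both real distribution functions are onto
  -- `[0,1]`, so the values can be matched regardless.
  obtain ⟨t', ht', htt'⟩ := (hπ.bijOn_condCDF hδ hM hML hC hC' hk hy).surjOn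
    ((hρ.bijOn_condCDF hδ hM hML hC hC' hk hx).mapsTo ht)
  refine ⟨t', ht', ?_⟩
  have h1 := hρ.norm_halfPrimitive_sub_le hδ hM hML hC0 hC hk hx hxz ht
  have h2 := hπ.norm_halfPrimitive_sub_le hδ hM hML hC0 hC hk hy hyw ht'
  rw [hρ.halfPrimitive_complexCond_toComplex hδ hCM hk hx ht] at h1
  rw [hπ.halfPrimitive_complexCond_toComplex hδ hCM hk hy ht', htt', norm_sub_rev] at h2
  have hs : s ∈ strip (δ ⟨k, hk⟩) := mem_strip_iff.2 ⟨t, ht, hst⟩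
  have h3 := (convex_strip (δ ⟨k, hk⟩)).norm_image_sub_le_of_norm_hasDerivWithin_le (C := L / M)
    (fun v hv => (hasDerivAt_halfPrimitive (hδ ⟨k, hk⟩)
      (hρ.differentiableOn_complexCond hδ hCM hk hz) hv).hasDerivWithinAt)
    (fun v hv => by
      rw [norm_div, Complex.norm_ofNat]
      linarith [(hρ.complexCond_bounds hδ hM hML hC hC' hk hz hv).1])
    (ofReal_mem_strip (hδ _) ht) hs
  have h4 := norm_sub_le_norm_sub_add_norm_sub (halfPrimitive (complexCond gρ k z) s)
    (halfPrimitive (complexCond gρ k z) t) (halfPrimitive (complexCond gπ k w) t')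
  have h5 := norm_sub_le_norm_sub_add_norm_sub (halfPrimitive (complexCond gρ k z) t)
    (condCDF fρ k x t : ℂ) (halfPrimitive (complexCond gπ k w) t')
  linarith

/-- The `κ` of `exists_expansion_constant` for the half primitives of conditional densities. -/
def IsExpansionConstant (M L κ : ℝ) : Prop :=
  ∀ (S : Set ℂ) (h h' : ℂ → ℂ), Convex ℝ S → (∀ s ∈ S, HasDerivAt h (h' s) s) →
    (∀ s ∈ S, ‖h' s‖ ≤ L / M) → (∀ s ∈ S, M / (4 * L) ≤ (h' s).re) →
    InjOn h S ∧ ∀ s₀ r, 0 ≤ r → closedBall s₀ r ⊆ S →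
      SurjOn h (closedBall s₀ r) (closedBall (h s₀) (κ * r))

lemma DensityAssumption.injOn_and_surjOn_halfPrimitive {κ : ℝ} (hκ : IsExpansionConstant M L κ)
    (hπ : DensityAssumption M L C δ fπ gπ) (hδ : ∀ i, 0 < δ i) (hM : 0 < M) (hML : M ≤ L)
    (hC : C ≤ M / 2) (hC' : 4 * L / M ^ 2 * C ≤ M / (4 * L)) {k : ℕ} (hk : k < d)
    {w : Fin k → ℂ} (hw : w ∈ polystrip (head δ hk.le)) :
    InjOn (halfPrimitive (complexCond gπ k w)) (strip (δ ⟨k, hk⟩)) ∧ ∀ s₀ r, 0 ≤ r →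
      closedBall s₀ r ⊆ strip (δ ⟨k, hk⟩) →
      SurjOn (halfPrimitive (complexCond gπ k w)) (closedBall s₀ r)
        (closedBall (halfPrimitive (complexCond gπ k w) s₀) (κ * r)) := by
  refine hκ _ _ (fun s => complexCond gπ k w s / 2) (convex_strip _)
    (fun s hs => hasDerivAt_halfPrimitive (hδ ⟨k, hk⟩)
      (hπ.differentiableOn_complexCond hδ (by linarith) hk hw) hs) (fun s hs => ?_) fun s hs => ?_
  · have := (hπ.complexCond_bounds hδ hM hML hC hC' hk hw hs).1
    rw [norm_div, Complex.norm_ofNat]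
    linarith
  · have := (hπ.complexCond_bounds hδ hM hML hC hC' hk hw hs).2.1
    have h1 : M / (4 * L) = M / (2 * L) / 2 := by ring
    have h2 : (complexCond gπ k w s / 2).re = (complexCond gπ k w s).re / 2 := by simp
    rw [h1, h2]
    linarith

/-- The ball of radius `r` about the approximate solution `t'` has an image covering the ball of
radius `κ * r`, which contains the value to be attained. -/
lemma exists_solution {κ : ℝ} (hκ : IsExpansionConstant M L κ)
    (hρ : DensityAssumption M L C δ fρ gρ)
    (hπ : DensityAssumption M L C δ fπ gπ) (hδ : ∀ i, 0 < δ i) (hM : 0 < M) (hML : M ≤ L)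
    (hC0 : 0 ≤ C) (hC : C ≤ M / 2) (hC' : 4 * L / M ^ 2 * C ≤ M / (4 * L)) {k : ℕ} (hk : k < d)
    {z w : Fin k → ℂ} (hz : z ∈ polystrip (head δ hk.le)) (hw : w ∈ polystrip (head δ hk.le))
    {s : ℂ} {t : ℝ} (ht : t ∈ Icc (-1 : ℝ) 1) (hst : ‖s - t‖ < δ ⟨k, hk⟩) {r : ℝ} (hr0 : 0 ≤ r)
    (hr : r < δ ⟨k, hk⟩)
    (hκr : L / M * ‖s - t‖ + 2 * (4 * L / M ^ 2 * (C * min 1 (δ ⟨k, hk⟩))) ≤ κ * r) :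
    ∃ t' ∈ Icc (-1 : ℝ) 1, ∃ σ : ℂ, ‖σ - t'‖ ≤ r ∧
      halfPrimitive (complexCond gπ k w) σ = halfPrimitive (complexCond gρ k z) s := by
  obtain ⟨t', ht', h1⟩ := exists_near_solution hρ hπ hδ hM hML hC0 hC hC' hk hz hw ht hst
  have hball : closedBall (t' : ℂ) r ⊆ strip (δ ⟨k, hk⟩) := by
    intro v hv
    rw [mem_closedBall, dist_eq_norm] at hv
    exact mem_strip_iff.2 ⟨t', ht', hv.trans_lt hr⟩
  obtain ⟨σ, hσ, hσ'⟩ := (hπ.injOn_and_surjOn_halfPrimitive hκ hδ hM hML hC hC' hk hw).2 t' r hr0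
    hball (mem_closedBall_iff_norm.2 (h1.trans hκr))
  exact ⟨t', ht', σ, mem_closedBall_iff_norm.1 hσ, hσ'⟩

end Step

/-! ### Holomorphic extension of the map, component by component -/

variable {d : ℕ} {M L C κ c : ℝ} {δ : Fin d → ℝ} {fρ fπ : (Fin d → ℝ) → ℝ}
  {gρ gπ : (Fin d → ℂ) → ℂ}

lemma polystrip_mono {ι : Type*} {δ δ' : ι → ℝ} (h : ∀ i, δ i ≤ δ' i) :
    polystrip δ ⊆ polystrip δ' :=
  fun _ hz i => thickening_mono (h i) _ (hz i)

/-- `T` is a holomorphic extension of the first `k` components of the Knothe–Rosenblatt map,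
mapping the polystrip of radii `c * δ` to that of radii `δ`. -/
structure IsComplexMap (c : ℝ) (δ : Fin d → ℝ) (fρ fπ : (Fin d → ℝ) → ℝ) {k : ℕ} (hk : k ≤ d)
    (T : (Fin k → ℂ) → Fin k → ℂ) : Prop where
  contDiffOn : ContDiffOn ℂ 1 T (polystrip (head (fun i => c * δ i) hk))
  mapsTo : MapsTo T (polystrip (head (fun i => c * δ i) hk)) (polystrip (head δ hk))
  mem_cube : ∀ x ∈ cube (Fin k), krMap fρ fπ k x ∈ cube (Fin k)
  apply_toComplex : ∀ x ∈ cube (Fin k), T (toComplex x) = toComplex (krMap fρ fπ k x)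

/-- `τ` is a holomorphic extension of the component with index `k` of the Knothe–Rosenblatt map,
for a given extension `T` of the components before it. -/
structure IsComplexComponent (c : ℝ) (δ : Fin d → ℝ) (fρ fπ : (Fin d → ℝ) → ℝ)
    (gρ gπ : (Fin d → ℂ) → ℂ) {k : ℕ} (hk : k < d) (T : (Fin k → ℂ) → Fin k → ℂ)
    (τ : (Fin (k + 1) → ℂ) → ℂ) : Prop where
  contDiffOn : ContDiffOn ℂ 1 τ (polystrip (head (fun i => c * δ i) (Nat.succ_le_of_lt hk)))
  mem_strip : ∀ z ∈ polystrip (head (fun i => c * δ i) (Nat.succ_le_of_lt hk)),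
    τ z ∈ strip (δ ⟨k, hk⟩)
  solves : ∀ z ∈ polystrip (head (fun i => c * δ i) (Nat.succ_le_of_lt hk)),
    halfPrimitive (complexCond gπ k (T (Fin.init z))) (τ z) =
      halfPrimitive (complexCond gρ k (Fin.init z)) (z (Fin.last k))
  near : ∀ z ∈ polystrip (head (fun i => c * δ i) (Nat.succ_le_of_lt hk)),
    z (Fin.last k) ∈ complexInterval →
      ∃ t ∈ Icc (-1 : ℝ) 1, ‖τ z - t‖ ≤ min 1 (δ ⟨k, hk⟩) / 2
  mem_Icc : ∀ x ∈ cube (Fin (k + 1)), krComponent fρ fπ k x ∈ Icc (-1 : ℝ) 1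
  apply_toComplex : ∀ x ∈ cube (Fin (k + 1)), τ (toComplex x) = (krComponent fρ fπ k x : ℂ)

/-- The smallness conditions on the constants under which the construction works. -/
structure Admissible (M L C κ c : ℝ) : Prop where
  M_pos : 0 < M
  M_le_L : M ≤ L
  expansion : IsExpansionConstant M L κ
  C_nonneg : 0 ≤ C
  C_le : C ≤ M / 2
  C_le' : 4 * L / M ^ 2 * C ≤ M / (4 * L)
  C_le_κ : 2 * (4 * L / M ^ 2 * C) ≤ κ / 4
  c_pos : 0 < c
  c_le_one : c ≤ 1
  c_le_κ : L / M * c ≤ κ / 4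

lemma krComponent_eq {k : ℕ} (x : Fin (k + 1) → ℝ) :
    krComponent fρ fπ k x = Function.invFunOn (condCDF fπ k (krMap fρ fπ k (Fin.init x)))
      (Icc (-1 : ℝ) 1) (condCDF fρ k (Fin.init x) (x (Fin.last k))) := by
  simp [krComponent, krMap]

lemma krMap_succ {k : ℕ} (x : Fin (k + 1) → ℝ) :
    krMap fρ fπ (k + 1) x =
      Fin.snoc (α := fun _ => ℝ) (krMap fρ fπ k (Fin.init x)) (krComponent fρ fπ k x) := by
  rw [krComponent_eq, krMap]

/-- Roots are found by `exists_solution`. Their uniqueness in the strip then identifies the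
pointwise choice with the local implicit function, with the root close to `[-1,1]` when the last
variable is real, and with the real map on the cube. -/
lemma exists_isComplexComponent (ha : Admissible M L C κ c) (hδ : ∀ i, 0 < δ i)
    (hρ : DensityAssumption M L C δ fρ gρ) (hπ : DensityAssumption M L C δ fπ gπ) {k : ℕ}
    (hk : k < d) {T : (Fin k → ℂ) → Fin k → ℂ} (hT : IsComplexMap c δ fρ fπ hk.le T) :
    ∃ τ, IsComplexComponent c δ fρ fπ gρ gπ hk T τ := by
  obtain ⟨hM, hML, hκ, hC0, hC, hC', hCκ, hc0, hc1, hcκ⟩ := ha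
  have hL : 0 < L := hM.trans_le hML
  have hCM : C < M := by linarith
  set η := δ ⟨k, hk⟩ with hη
  have hη0 : 0 < η := hδ _
  have hcδ : ∀ i, c * δ i ≤ δ i := fun i => mul_le_of_le_one_left (hδ i).le hc1
  have hcδ0 : ∀ i, 0 < c * δ i := fun i => mul_pos hc0 (hδ i)
  set Z := polystrip (head (fun i => c * δ i) (Nat.succ_le_of_lt hk)) with hZ
  have hfront : ∀ z ∈ Z, Fin.init z ∈ polystrip (head (fun i => c * δ i) hk.le) :=
    fun z hz => init_mem_polystrip hk hz
  have hfront' : ∀ z ∈ Z, Fin.init z ∈ polystrip (head δ hk.le) :=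
    fun z hz => polystrip_mono (fun i => hcδ _) (hfront z hz)
  have hlast : ∀ z ∈ Z, z (Fin.last k) ∈ strip (c * η) := fun z hz => last_mem_strip hk hz
  have hlast' : ∀ z ∈ Z, z (Fin.last k) ∈ strip η :=
    fun z hz => thickening_mono (hcδ _) _ (hlast z hz)
  have hTz : ∀ z ∈ Z, T (Fin.init z) ∈ polystrip (head δ hk.le) :=
    fun z hz => hT.mapsTo (hfront z hz)
  have hinj : ∀ z ∈ Z, InjOn (halfPrimitive (complexCond gπ k (T (Fin.init z)))) (strip η) :=
    fun z hz => (hπ.injOn_and_surjOn_halfPrimitive hκ hδ hM hML hC hC' hk (hTz z hz)).1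
  have hmin0 : 0 < min 1 η := lt_min one_pos hη0
  have hsmall : 2 * (4 * L / M ^ 2 * (C * min 1 η)) ≤ κ / 4 * min 1 η := by
    calc _ = 2 * (4 * L / M ^ 2 * C) * min 1 η := by ring
      _ ≤ _ := by gcongr
  have hκ0 : 0 ≤ κ := by
    have : 0 ≤ 2 * (4 * L / M ^ 2 * C) := by positivity
    linarith
  have hex : ∀ z ∈ Z, ∃ σ ∈ strip η, halfPrimitive (complexCond gπ k (T (Fin.init z))) σ =
      halfPrimitive (complexCond gρ k (Fin.init z)) (z (Fin.last k)) := by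
    intro z hz
    obtain ⟨t, ht, hst⟩ := mem_strip_iff.1 (hlast z hz)
    -- The displacement from the real interval and the smallness error each use at most `κ / 4 * η`,
    -- which together fill `κ * (η / 2)`.
    obtain ⟨t', ht', σ, hσ, hσ'⟩ := exists_solution hκ hρ hπ hδ hM hML hC0 hC hC' hk (hfront' z hz)
      (hTz z hz) ht (hst.trans_le (hcδ _)) (r := η / 2) (by positivity) (by linarith) (by
        have h1 : L / M * ‖z (Fin.last k) - t‖ ≤ κ / 4 * η := by
          calc _ ≤ L / M * (c * η) := by gcongr
            _ = L / M * c * η := by ring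
            _ ≤ _ := by gcongr
        have h2 : κ / 4 * min 1 η ≤ κ / 4 * η := by
          gcongr
          exact min_le_right _ _
        linarith)
    exact ⟨σ, mem_strip_iff.2 ⟨t', ht', by linarith⟩, hσ'⟩
  choose! τ hτS hτ using hex
  have hreal : ∀ x ∈ cube (Fin (k + 1)), krComponent fρ fπ k x ∈ Icc (-1 : ℝ) 1 ∧
      condCDF fπ k (krMap fρ fπ k (Fin.init x)) (krComponent fρ fπ k x) =
        condCDF fρ k (Fin.init x) (x (Fin.last k)) := by
    intro x hx
    have hx' : (Fin.init x : Fin k → ℝ) ∈ cube (Fin k) := fun i => hx _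
    have h1 := (hπ.bijOn_condCDF hδ hM hML hC hC' hk (hT.mem_cube _ hx')).surjOn
      ((hρ.bijOn_condCDF hδ hM hML hC hC' hk hx').mapsTo (hx (Fin.last k)))
    rw [krComponent_eq]
    exact ⟨Function.invFunOn_mem h1, Function.invFunOn_eq h1⟩
  refine ⟨τ, ?_, hτS, hτ, ?_, fun x hx => (hreal x hx).1, ?_⟩
  · have hZo : IsOpen Z := isOpen_polystrip _
    have hPo : IsOpen (polystrip (head δ hk.le)) := isOpen_polystrip _
    have hcd : ∀ {f : (Fin d → ℝ) → ℝ} {g : (Fin d → ℂ) → ℂ}, DensityAssumption M L C δ f g →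
        ContDiffOn ℂ 1 (fun p : (Fin k → ℂ) × ℂ => halfPrimitive (complexCond g k p.1) p.2)
          (polystrip (head δ hk.le) ×ˢ strip η) := fun h =>
      contDiffOn_halfPrimitive hPo hη0 (h.contDiffOn_complexCond hδ hCM hk)
    have hcd_front : ContDiff ℂ 1 fun z : Fin (k + 1) → ℂ => (Fin.init z : Fin k → ℂ) :=
      contDiff_fst.comp (contDiff_front_last k)
    have h1 : ContDiffOn ℂ 1 (fun z => halfPrimitive (complexCond gρ k (Fin.init z))
        (z (Fin.last k))) Z :=
      (hcd hρ).comp (contDiff_front_last k).contDiffOn fun z hz => ⟨hfront' z hz, hlast' z hz⟩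
    have hTc : ContDiffOn ℂ 1 (fun z : Fin (k + 1) → ℂ => T (Fin.init z)) Z :=
      hT.contDiffOn.comp hcd_front.contDiffOn hfront
    have h2 : ContDiffOn ℂ 1 (fun p : (Fin (k + 1) → ℂ) × ℂ =>
        halfPrimitive (complexCond gπ k (T (Fin.init p.1))) p.2) (Z ×ˢ strip η) :=
      (hcd hπ).comp ((hTc.comp contDiffOn_fst fun p hp => hp.1).prodMk contDiffOn_snd)
        fun p hp => ⟨hTz _ hp.1, hp.2⟩
    refine contDiffOn_of_implicit hZo (isOpen_strip η)
      (Ψ := fun p => halfPrimitive (complexCond gπ k (T (Fin.init p.1))) p.2 -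
        halfPrimitive (complexCond gρ k (Fin.init p.1)) (p.1 (Fin.last k)))
      (Ψ' := fun z s => complexCond gπ k (T (Fin.init z)) s / 2)
      (h2.sub (h1.comp contDiffOn_fst fun p hp => hp.1)) ?_ ?_ ?_ hτS ?_
    · intro z hz s hs
      exact (hasDerivAt_halfPrimitive hη0
        (hπ.differentiableOn_complexCond hδ hCM hk (hTz z hz)) hs).sub_const
          (halfPrimitive (complexCond gρ k (Fin.init z)) (z (Fin.last k)))
    · intro z hz s hs h0
      have h3 := (hπ.complexCond_bounds hδ hM hML hC hC' hk (hTz z hz) hs).2.1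
      have h4 : 0 < M / (2 * L) := by positivity
      rw [div_eq_zero_iff] at h0
      rcases h0 with h0 | h0
      · rw [h0, Complex.zero_re] at h3
        linarith
      · norm_num at h0
    · intro z hz s hs s' hs' h
      exact hinj z hz hs hs' (sub_left_injective h)
    · intro z hz
      exact sub_eq_zero.2 (hτ z hz)
  · rintro z hz ⟨t, ht, htz⟩
    simp only at htz
    -- With a real last variable the displacement term vanishes. What remains is proportional to
    -- `min 1 η`, which permits the radius `min 1 η / 2`.
    obtain ⟨t', ht', σ, hσ, hσ'⟩ := exists_solution hκ hρ hπ hδ hM hML hC0 hC hC' hk (hfront' z hz)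
      (hTz z hz) ht (s := z (Fin.last k)) (r := min 1 η / 2) (by rw [← htz]; simpa using hη0)
      (by positivity) (by linarith [min_le_right 1 η]) (by
        rw [← htz, sub_self, norm_zero, mul_zero, zero_add]
        have : 0 ≤ κ * min 1 η := by positivity
        linarith)
    have hσS : σ ∈ strip η :=
      mem_strip_iff.2 ⟨t', ht', by linarith [min_le_right 1 η]⟩
    refine ⟨t', ht', ?_⟩
    rwa [hinj z hz (hτS z hz) hσS ((hτ z hz).trans hσ'.symm)]
  · intro x hx
    have hxZ : toComplex x ∈ Z := toComplex_mem_polystrip (fun i => hcδ0 _) hx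
    have hx' : (Fin.init x : Fin k → ℝ) ∈ cube (Fin k) := fun i => hx _
    obtain ⟨h1, h2⟩ := hreal x hx
    have hfront_toComplex : (Fin.init (toComplex x) : Fin k → ℂ) = toComplex (Fin.init x) := rfl
    refine hinj _ hxZ (hτS _ hxZ) (ofReal_mem_strip hη0 h1) ((hτ _ hxZ).trans ?_)
    rw [hfront_toComplex, hT.apply_toComplex _ hx',
      hπ.halfPrimitive_complexCond_toComplex hδ hCM hk (hT.mem_cube _ hx') h1, h2]
    exact hρ.halfPrimitive_complexCond_toComplex hδ hCM hk hx' (hx (Fin.last k))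

/-- The induction does not shrink `c`: a step only asks that the earlier components land in the
polystrip of radii `δ`, and its own component lands in the strip of radius `δ k`. -/
lemma exists_isComplexMap (ha : Admissible M L C κ c) (hδ : ∀ i, 0 < δ i)
    (hρ : DensityAssumption M L C δ fρ gρ) (hπ : DensityAssumption M L C δ fπ gπ) :
    ∀ {k : ℕ} (hk : k ≤ d), ∃ T, IsComplexMap c δ fρ fπ hk T
  | 0, hk => ⟨id, contDiffOn_id, fun _ _ i => i.elim0, fun _ _ i => i.elim0,
      fun _ _ => Subsingleton.elim _ _⟩
  | k + 1, hk => by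
    have hk' : k < d := hk
    obtain ⟨T, hT⟩ := exists_isComplexMap ha hδ hρ hπ hk'.le
    obtain ⟨τ, hτ⟩ := exists_isComplexComponent ha hδ hρ hπ hk' hT
    have hcd_front : ContDiff ℂ 1 fun z : Fin (k + 1) → ℂ => (Fin.init z : Fin k → ℂ) :=
      contDiff_fst.comp (contDiff_front_last k)
    refine ⟨fun z => Fin.snoc (α := fun _ => ℂ) (T (Fin.init z)) (τ z), ?_, ?_, ?_, ?_⟩
    · exact (contDiff_snoc k).comp_contDiffOn
        ((hT.contDiffOn.comp hcd_front.contDiffOn fun z hz => init_mem_polystrip hk' hz).prodMk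
          hτ.contDiffOn)
    · exact fun z hz => snoc_mem_polystrip hk' (hT.mapsTo (init_mem_polystrip hk' hz))
        (hτ.mem_strip z hz)
    · intro x hx
      rw [krMap_succ]
      exact snoc_mem_cube (hT.mem_cube _ fun i => hx _) (hτ.mem_Icc x hx)
    · intro x hx
      rw [krMap_succ, toComplex_snoc, hτ.apply_toComplex x hx, 
        ← hT.apply_toComplex (Fin.init x) fun i => hx _]
      rfl

/-! ### The derivative in the last variable -/

/-- The derivative of a holomorphic component of the Knothe–Rosenblatt map in its last variable. -/
def complexDeriv (gρ gπ : (Fin d → ℂ) → ℂ) {k : ℕ} (T : (Fin k → ℂ) → Fin k → ℂ)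
    (τ : (Fin (k + 1) → ℂ) → ℂ) (z : Fin (k + 1) → ℂ) : ℂ :=
  complexCond gρ k (Fin.init z) (z (Fin.last k)) / complexCond gπ k (T (Fin.init z)) (τ z)

/-- With `Λ = L / M`, the real part of `u / v` is `(u.re * v.re + u.im * v.im) / ‖v‖²`. The first
product is at least `1 / (4Λ²)` and the second at most `1 / (16Λ²)` in modulus, leaving `3 /
(16Λ²)`. The constant `200` is generous, so that one value also serves part (b). -/
lemma norm_div_sub_one_le_and_re {M L : ℝ} (hM : 0 < M) (hML : M ≤ L) {u v : ℂ}
    (hu : ‖u‖ ≤ 2 * (L / M)) (hv : ‖v‖ ≤ 2 * (L / M)) (hur : M / (2 * L) ≤ u.re)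
    (hvr : M / (2 * L) ≤ v.re) (hui : |u.im| ≤ M / (4 * L)) (hvi : |v.im| ≤ M / (4 * L)) :
    ‖u / v - 1‖ < 200 * (L / M) ^ 4 ∧ 1 / (200 * (L / M) ^ 4) ≤ (u / v).re := by
  have hL : 0 < L := hM.trans_le hML
  set Λ := L / M with hΛ
  have hΛ1 : 1 ≤ Λ := (one_le_div hM).2 hML
  have e1 : M / (2 * L) = 1 / (2 * Λ) := by
    rw [hΛ]
    field_simp
  have e2 : M / (4 * L) = 1 / (4 * Λ) := by
    rw [hΛ]
    field_simp
  rw [e1] at hur hvr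
  rw [e2] at hui hvi
  have hΛ0 : 0 < Λ := by linarith
  have hvn : 1 / (2 * Λ) ≤ ‖v‖ := hvr.trans ((le_abs_self _).trans (Complex.abs_re_le_norm v))
  have hv0 : 0 < ‖v‖ := lt_of_lt_of_le (by positivity) hvn
  have hΛ24 : Λ ^ 2 ≤ Λ ^ 4 := pow_le_pow_right₀ hΛ1 (by norm_num)
  have hΛ2 : 1 ≤ Λ ^ 2 := one_le_pow₀ hΛ1
  constructor
  · have h1 : ‖u / v‖ ≤ 4 * Λ ^ 2 := by
      rw [norm_div, div_le_iff₀ hv0]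
      calc ‖u‖ ≤ 2 * Λ := hu
        _ = 4 * Λ ^ 2 * (1 / (2 * Λ)) := by
          field_simp
          ring
        _ ≤ _ := by gcongr
    have h2 := norm_sub_le (u / v) 1
    rw [norm_one] at h2
    linarith
  · have h1 : 1 / (2 * Λ) * (1 / (2 * Λ)) ≤ u.re * v.re :=
      mul_le_mul hur hvr (by positivity) (le_trans (by positivity) hur)
    have h2 : |u.im * v.im| ≤ 1 / (4 * Λ) * (1 / (4 * Λ)) := by
      rw [abs_mul]
      exact mul_le_mul hui hvi (abs_nonneg _) (by positivity)
    have h3 := (abs_le.1 h2).1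
    have h4 : Complex.normSq v ≤ (2 * Λ) ^ 2 := by
      rw [Complex.normSq_eq_norm_sq]
      gcongr
    have h5 : 0 < Complex.normSq v := by
      rw [Complex.normSq_eq_norm_sq]
      positivity
    have h6 : 3 / (16 * Λ ^ 2) ≤ u.re * v.re + u.im * v.im := by
      have : 3 / (16 * Λ ^ 2) = 1 / (2 * Λ) * (1 / (2 * Λ)) - 1 / (4 * Λ) * (1 / (4 * Λ)) := by
        field_simp
        norm_num
      linarith
    rw [Complex.div_re, ← add_div, le_div_iff₀ h5]
    calc 1 / (200 * Λ ^ 4) * Complex.normSq v ≤ 1 / (200 * Λ ^ 4) * (2 * Λ) ^ 2 := by gcongr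
      _ = 1 / (50 * Λ ^ 2) := by
        field_simp
        norm_num
      _ ≤ 3 / (16 * Λ ^ 2) := by
        rw [div_le_div_iff₀ (by positivity) (by positivity)]
        nlinarith
      _ ≤ _ := h6

section Component

variable {k : ℕ} {hk : k < d} {T : (Fin k → ℂ) → Fin k → ℂ} {τ : (Fin (k + 1) → ℂ) → ℂ}

namespace IsComplexComponent

lemma contDiffOn_complexDeriv (hτ : IsComplexComponent c δ fρ fπ gρ gπ hk T τ)
    (hT : IsComplexMap c δ fρ fπ hk.le T) (ha : Admissible M L C κ c) (hδ : ∀ i, 0 < δ i)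
    (hρ : DensityAssumption M L C δ fρ gρ) (hπ : DensityAssumption M L C δ fπ gπ) :
    ContDiffOn ℂ 1 (complexDeriv gρ gπ T τ)
      (polystrip (head (fun i => c * δ i) (Nat.succ_le_of_lt hk))) := by
  have hM := ha.M_pos
  have hL : 0 < L := hM.trans_le ha.M_le_L
  have hCM : C < M := by linarith [ha.C_le]
  have hcδ : ∀ i, c * δ i ≤ δ i := fun i => mul_le_of_le_one_left (hδ i).le ha.c_le_one
  have hcd_front : ContDiff ℂ 1 fun z : Fin (k + 1) → ℂ => (Fin.init z : Fin k → ℂ) :=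
    contDiff_fst.comp (contDiff_front_last k)
  have h1 := (hρ.contDiffOn_complexCond hδ hCM hk).comp
    (s := polystrip (head (fun i => c * δ i) (Nat.succ_le_of_lt hk)))
    (contDiff_front_last k).contDiffOn fun z hz =>
      ⟨polystrip_mono (fun i => hcδ _) (init_mem_polystrip hk hz),
        thickening_mono (hcδ _) _ (last_mem_strip hk hz)⟩
  have h2 := (hπ.contDiffOn_complexCond hδ hCM hk).comp
    ((hT.contDiffOn.comp hcd_front.contDiffOn fun z hz => init_mem_polystrip hk hz).prodMk
      hτ.contDiffOn) fun z hz => ⟨hT.mapsTo (init_mem_polystrip hk hz), hτ.mem_strip z hz⟩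
  refine h1.div h2 fun z hz h0 => ?_
  have h3 := (hπ.complexCond_bounds hδ hM ha.M_le_L ha.C_le ha.C_le' hk
    (hT.mapsTo (init_mem_polystrip hk hz)) (hτ.mem_strip z hz)).2.1
  have h4 : 0 < M / (2 * L) := by positivity
  rw [h0, Complex.zero_re] at h3
  linarith

lemma complexDeriv_bounds (hτ : IsComplexComponent c δ fρ fπ gρ gπ hk T τ)
    (hT : IsComplexMap c δ fρ fπ hk.le T) (ha : Admissible M L C κ c) (hδ : ∀ i, 0 < δ i)
    (hρ : DensityAssumption M L C δ fρ gρ) (hπ : DensityAssumption M L C δ fπ gπ)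
    {z : Fin (k + 1) → ℂ} (hz : z ∈ polystrip (head (fun i => c * δ i) (Nat.succ_le_of_lt hk))) :
    ‖complexDeriv gρ gπ T τ z - 1‖ < 200 * (L / M) ^ 4 ∧
      1 / (200 * (L / M) ^ 4) ≤ (complexDeriv gρ gπ T τ z).re := by
  have hcδ : ∀ i, c * δ i ≤ δ i := fun i => mul_le_of_le_one_left (hδ i).le ha.c_le_one
  obtain ⟨h1, h2, h3⟩ := hρ.complexCond_bounds hδ ha.M_pos ha.M_le_L ha.C_le ha.C_le' hk
    (polystrip_mono (fun i => hcδ _) (init_mem_polystrip hk hz))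
    (thickening_mono (hcδ _) _ (last_mem_strip hk hz))
  obtain ⟨h4, h5, h6⟩ := hπ.complexCond_bounds hδ ha.M_pos ha.M_le_L ha.C_le ha.C_le' hk
    (hT.mapsTo (init_mem_polystrip hk hz)) (hτ.mem_strip z hz)
  exact norm_div_sub_one_le_and_re ha.M_pos ha.M_le_L h1 h4 h2 h5 h3 h6

lemma norm_complexDeriv_sub_one_lt (hτ : IsComplexComponent c δ fρ fπ gρ gπ hk T τ)
    (hT : IsComplexMap c δ fρ fπ hk.le T) (ha : Admissible M L C κ c) (hδ : ∀ i, 0 < δ i)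
    (hρ : DensityAssumption M L C δ fρ gρ) (hπ : DensityAssumption M L C δ fπ gπ)
    {z : Fin (k + 1) → ℂ} (hz : z ∈ polystrip (head (fun i => c * δ i) (Nat.succ_le_of_lt hk)))
    (hlast : z (Fin.last k) ∈ complexInterval) :
    ‖complexDeriv gρ gπ T τ z - 1‖ < 200 * (L / M) ^ 4 / max 1 (δ ⟨k, hk⟩) := by
  -- For `δ k ≤ 1` the general bound suffices. Otherwise both conditional densities are within `24
  -- (L / M) / δ k` of `1`, and the modulus of the denominator is bounded below.
  rcases le_total (δ ⟨k, hk⟩) 1 with hle | hle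
  · rw [max_eq_left hle, div_one]
    exact (hτ.complexDeriv_bounds hT ha hδ hρ hπ hz).1
  rw [max_eq_right hle]
  have hM := ha.M_pos
  have hL : 0 < L := hM.trans_le ha.M_le_L
  have hη0 : 0 < δ ⟨k, hk⟩ := hδ _
  have hcδ : ∀ i, c * δ i ≤ δ i := fun i => mul_le_of_le_one_left (hδ i).le ha.c_le_one
  have hwz := hT.mapsTo (init_mem_polystrip hk hz)
  obtain ⟨t', ht', htt'⟩ := hτ.near z hz hlast
  obtain ⟨t, ht, htz⟩ := hlast
  have hu := hρ.norm_complexCond_sub_one_le hδ hM ha.M_le_L ha.C_le ha.C_le' hk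
    (polystrip_mono (fun i => hcδ _) (init_mem_polystrip hk hz)) ht (s := z (Fin.last k)) (by
      rw [← htz]
      simp only [sub_self, norm_zero]
      positivity)
  have hv := hπ.norm_complexCond_sub_one_le hδ hM ha.M_le_L ha.C_le ha.C_le' hk hwz ht' htt'
  have hvr := (hπ.complexCond_bounds hδ hM ha.M_le_L ha.C_le ha.C_le' hk hwz
    (hτ.mem_strip z hz)).2.1
  unfold complexDeriv
  set u := complexCond gρ k (Fin.init z) (z (Fin.last k))
  set v := complexCond gπ k (T (Fin.init z)) (τ z)
  set Λ := L / M with hΛ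
  have hΛ1 : 1 ≤ Λ := (one_le_div hM).2 ha.M_le_L
  have hΛ0 : 0 < Λ := by linarith
  have e1 : M / (2 * L) = 1 / (2 * Λ) := by
    rw [hΛ]
    field_simp
  rw [e1] at hvr
  have hvn : 1 / (2 * Λ) ≤ ‖v‖ := hvr.trans ((le_abs_self _).trans (Complex.abs_re_le_norm v))
  have hv0 : 0 < ‖v‖ := lt_of_lt_of_le (by positivity) hvn
  have hΛ24 : Λ ^ 2 ≤ Λ ^ 4 := pow_le_pow_right₀ hΛ1 (by norm_num)
  have hΛ2 : 1 ≤ Λ ^ 2 := one_le_pow₀ hΛ1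
  have h1 : ‖u - v‖ ≤ 48 * Λ / δ ⟨k, hk⟩ := by
    have h2 := norm_sub_le_norm_sub_add_norm_sub u 1 v
    rw [norm_sub_rev 1 v] at h2
    calc _ ≤ _ := h2
      _ ≤ _ := add_le_add hu hv
      _ = _ := by ring
  rw [div_sub_one (norm_pos_iff.1 hv0), norm_div, div_lt_iff₀ hv0]
  calc ‖u - v‖ ≤ 48 * Λ / δ ⟨k, hk⟩ := h1
    _ = 96 * Λ ^ 2 / δ ⟨k, hk⟩ * (1 / (2 * Λ)) := by
      field_simp
      norm_num
    _ < 200 * Λ ^ 4 / δ ⟨k, hk⟩ * (1 / (2 * Λ)) := by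
      gcongr ?_ / _ * _
      linarith
    _ ≤ _ := by gcongr

/-- Implicit differentiation of the equation `solves` along the last variable, in which `T (Fin.init
z)` is constant. The restriction to `[-1,1]` makes the derivative one-sided at the endpoints, where
nothing is known about the real component outside. -/
lemma hasDerivWithinAt_krComponent (hτ : IsComplexComponent c δ fρ fπ gρ gπ hk T τ)
    (hT : IsComplexMap c δ fρ fπ hk.le T) (ha : Admissible M L C κ c) (hδ : ∀ i, 0 < δ i)
    (hρ : DensityAssumption M L C δ fρ gρ) (hπ : DensityAssumption M L C δ fπ gπ)
    {x : Fin (k + 1) → ℝ} (hx : x ∈ cube (Fin (k + 1))) :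
    HasDerivWithinAt
      (fun s : ℝ => ((krComponent fρ fπ k (Function.update x (Fin.last k) s) : ℝ) : ℂ))
      (complexDeriv gρ gπ T τ (toComplex x)) (Icc (-1 : ℝ) 1) (x (Fin.last k)) := by
  have hM := ha.M_pos
  have hL : 0 < L := hM.trans_le ha.M_le_L
  have hCM : C < M := by linarith [ha.C_le]
  have hcδ : ∀ i, c * δ i ≤ δ i := fun i => mul_le_of_le_one_left (hδ i).le ha.c_le_one
  have hcδ0 : ∀ i, 0 < c * δ i := fun i => mul_pos ha.c_pos (hδ i)
  set Z := polystrip (head (fun i => c * δ i) (Nat.succ_le_of_lt hk)) with hZ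
  set z := toComplex x with hz
  have hzZ : z ∈ Z := toComplex_mem_polystrip (fun i => hcδ0 _) hx
  let line : ℂ → Fin (k + 1) → ℂ := fun s => Function.update z (Fin.last k) s
  have hline_self : line (z (Fin.last k)) = z := Function.update_eq_self _ _
  have hline : Differentiable ℂ line := fun s => (hasFDerivAt_update z s).differentiableAt
  have hτd : DifferentiableAt ℂ τ (line (z (Fin.last k))) := by
    rw [hline_self]
    exact (hτ.contDiffOn.differentiableOn one_ne_zero).differentiableAt
      ((isOpen_polystrip _).mem_nhds hzZ)
  have hcomp : HasDerivAt (τ ∘ line) (deriv (τ ∘ line) (z (Fin.last k))) (z (Fin.last k)) :=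
    (hτd.comp _ (hline _)).hasDerivAt
  have hfront : ∀ s, (Fin.init (line s) : Fin k → ℂ) = Fin.init z := fun s =>
    Fin.init_update_last z s
  have hwz := hT.mapsTo (init_mem_polystrip hk hzZ)
  have hv0 : complexCond gπ k (T (Fin.init z)) (τ z) ≠ 0 := by
    intro h0
    have h3 := (hπ.complexCond_bounds hδ hM ha.M_le_L ha.C_le ha.C_le' hk hwz
      (hτ.mem_strip z hzZ)).2.1
    have h4 : 0 < M / (2 * L) := by positivity
    rw [h0, Complex.zero_re] at h3
    linarith
  have hd1 : HasDerivAt (fun s => halfPrimitive (complexCond gπ k (T (Fin.init z))) (τ (line s)))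
      (complexCond gπ k (T (Fin.init z)) (τ z) / 2 * deriv (τ ∘ line) (z (Fin.last k)))
      (z (Fin.last k)) := by
    have h1 := hasDerivAt_halfPrimitive (hδ ⟨k, hk⟩)
      (hπ.differentiableOn_complexCond hδ hCM hk hwz) (hτ.mem_strip z hzZ)
    exact h1.comp_of_eq _ hcomp (by simp [hline_self])
  have hd2 : HasDerivAt (fun s => halfPrimitive (complexCond gπ k (T (Fin.init z))) (τ (line s)))
      (complexCond gρ k (Fin.init z) (z (Fin.last k)) / 2) (z (Fin.last k)) := by
    have h1 := hasDerivAt_halfPrimitive (hδ ⟨k, hk⟩)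
      (hρ.differentiableOn_complexCond hδ hCM hk
        (polystrip_mono (fun i => hcδ _) (init_mem_polystrip hk hzZ)))
      (thickening_mono (hcδ _) _ (last_mem_strip hk hzZ))
    refine h1.congr_of_eventuallyEq ?_
    have hmem : ∀ᶠ s in 𝓝 (z (Fin.last k)), line s ∈ Z :=
      hline.continuous.continuousAt.eventually_mem
        (by rw [hline_self]; exact (isOpen_polystrip _).mem_nhds hzZ)
    filter_upwards [hmem] with s hs
    have := hτ.solves _ hs
    rw [hfront] at this
    rw [this]
    simp [line]
  -- The same function was differentiated by the chain rule and through the equation; comparing the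
  -- results determines the derivative of `τ`.
  have hderiv : deriv (τ ∘ line) (z (Fin.last k)) = complexDeriv gρ gπ T τ z := by
    have h1 := hd1.unique hd2
    rw [complexDeriv, eq_div_iff hv0]
    linear_combination 2 * h1
  rw [hderiv] at hcomp
  have hreal : HasDerivAt (fun s : ℝ => (τ ∘ line) s) (complexDeriv gρ gπ T τ z)
      (x (Fin.last k)) := HasDerivAt.comp_ofReal (z := x (Fin.last k)) hcomp
  have hupd : ∀ s ∈ Icc (-1 : ℝ) 1,
      ((krComponent fρ fπ k (Function.update x (Fin.last k) s) : ℝ) : ℂ) = (τ ∘ line) s := by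
    intro s hs
    have hmem : Function.update x (Fin.last k) s ∈ cube (Fin (k + 1)) := by
      intro i
      by_cases hi : i = Fin.last k
      · subst hi
        simpa using hs
      · simpa [hi] using hx i
    rw [← hτ.apply_toComplex _ hmem, Function.comp_apply]
    congr 1
    ext i
    by_cases hi : i = Fin.last k
    · subst hi
      simp [toComplex, line]
    · simp [toComplex, line, hi, hz]
  exact hreal.hasDerivWithinAt.congr hupd (hupd _ (hx (Fin.last k)))

end IsComplexComponent

end Component

/-- `κ` depends only on `M` and `L`, and `C` and `c` are chosen small afterwards. The parameters `M
/ (4L)` and `L / M` are half the bounds of `complexCond_bounds`, because `halfPrimitive` has half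
the density as derivative. -/
lemma exists_admissible (hM : 0 < M) (hML : M ≤ L) :
    ∃ C κ c : ℝ, 0 < C ∧ Admissible M L C κ c := by
  have hL : 0 < L := hM.trans_le hML
  obtain ⟨κ, hκ0, hκ⟩ := exists_expansion_constant (m := M / (4 * L)) (l := L / M)
    (by positivity) (by
      rw [div_le_div_iff₀ (by positivity) hM]
      nlinarith)
  have hA : 0 < 4 * L / M ^ 2 := by positivity
  let C := min (M / 2) (min (M / (4 * L) / (4 * L / M ^ 2)) (κ / 8 / (4 * L / M ^ 2)))
  let c := min 1 (κ / 4 / (L / M))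
  have hC1 : C ≤ M / (4 * L) / (4 * L / M ^ 2) := (min_le_right _ _).trans (min_le_left _ _)
  have hC2 : C ≤ κ / 8 / (4 * L / M ^ 2) := (min_le_right _ _).trans (min_le_right _ _)
  have hc : c ≤ κ / 4 / (L / M) := min_le_right _ _
  have hC0 : 0 < C := by positivity
  rw [le_div_iff₀' hA] at hC1 hC2
  rw [le_div_iff₀' (by positivity)] at hc
  exact ⟨C, κ, c, hC0, hM, hML, hκ, hC0.le, min_le_left _ _, hC1, by linarith, by positivity,
    min_le_left _ _, hc⟩

end KnotheRosenblatt

end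

/-! ### The main theorem -/

theorem mainTheorem1 (M L : ℝ) (hM : 0 < M) (hML : M ≤ L) :
    ∃ C₆ C₇ C₈ : ℝ, 0 < C₆ ∧ 0 < C₇ ∧ 0 < C₈ ∧
      ∀ (d : ℕ) (δ : Fin d → ℝ), (∀ i, 0 < δ i) →
      ∀ (fρ fπ : (Fin d → ℝ) → ℝ) (gρ gπ : (Fin d → ℂ) → ℂ),
        KnotheRosenblatt.DensityAssumption M L C₆ δ fρ gρ →
        KnotheRosenblatt.DensityAssumption M L C₆ δ fπ gπ →
        ∀ k : Fin d, ∃ R : (Fin (k.val + 1) → ℂ) → ℂ,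
          -- `R` is the derivative of the `k`-th component in its last variable, on the real cube
          (∀ x ∈ KnotheRosenblatt.cube (Fin (k.val + 1)),
            HasDerivWithinAt
              (fun s : ℝ => ((KnotheRosenblatt.krComponent fρ fπ k.val
                (Function.update x (Fin.last k.val) s) : ℝ) : ℂ))
              (R (KnotheRosenblatt.toComplex x)) (Set.Icc (-1 : ℝ) 1) (x (Fin.last k.val))) ∧
          ContDiffOn ℂ 1 R (KnotheRosenblatt.polystrip
            fun i : Fin (k.val + 1) => C₇ * δ (Fin.castLE k.isLt i)) ∧
          (∀ z ∈ KnotheRosenblatt.polystrip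
              (fun i : Fin (k.val + 1) => C₇ * δ (Fin.castLE k.isLt i)),
            R z ∈ Metric.ball (1 : ℂ) C₈ ∧ 1 / C₈ ≤ (R z).re) ∧
          (1 ≤ k.val →
            ∀ z : Fin (k.val + 1) → ℂ,
              Fin.init z ∈ KnotheRosenblatt.polystrip
                (fun i : Fin k.val => C₇ * δ (Fin.castLE k.isLt.le i)) →
              z (Fin.last k.val) ∈ KnotheRosenblatt.complexInterval →
              R z ∈ Metric.ball (1 : ℂ) (C₈ / max 1 (δ k))) := by
  obtain ⟨C, κ, c, hC, ha⟩ := KnotheRosenblatt.exists_admissible hM hML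
  have hL : 0 < L := hM.trans_le hML
  refine ⟨C, c, 200 * (L / M) ^ 4, hC, ha.c_pos, by positivity, ?_⟩
  intro d δ hδ fρ fπ gρ gπ hρ hπ k
  obtain ⟨T, hT⟩ := KnotheRosenblatt.exists_isComplexMap ha hδ hρ hπ k.isLt.le
  obtain ⟨τ, hτ⟩ := KnotheRosenblatt.exists_isComplexComponent ha hδ hρ hπ k.isLt hT
  refine ⟨KnotheRosenblatt.complexDeriv gρ gπ T τ,
    fun x hx => hτ.hasDerivWithinAt_krComponent hT ha hδ hρ hπ hx,
    hτ.contDiffOn_complexDeriv hT ha hδ hρ hπ, fun z hz => ?_, fun _ z hz hlast => ?_⟩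
  · obtain ⟨h1, h2⟩ := hτ.complexDeriv_bounds hT ha hδ hρ hπ hz
    exact ⟨mem_ball_iff_norm.2 h1, h2⟩
  · refine mem_ball_iff_norm.2 (hτ.norm_complexDeriv_sub_one_lt hT ha hδ hρ hπ ?_ hlast)
    -- A point of `[-1,1]` lies in every strip, so the domain of (b) is contained in that of (a).
    have hs : z (Fin.last k.val) ∈ KnotheRosenblatt.strip (c * δ k) :=
      Metric.self_subset_thickening (mul_pos ha.c_pos (hδ k)) _ hlast
    rw [← Fin.snoc_init_self z]
    exact KnotheRosenblatt.snoc_mem_polystrip (δ := fun i => c * δ i) k.isLt hz hs
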